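/- Let $n\ge 3$, let $D_n$ be the closed unit disk with $n$ punctures (marked points) $p_1,\dots,p_n$ on the $y$-axis, numbered from bottom to top, and let $\mathcal{MCG}(D_n)$ be the group of homeomorphisms of the disk that fix the boundary pointwise and preserve the set of punctures, modulo isotopy through such homeomorphisms. For an embedded arc $\gamma$ in the interior of the disk that meets the punctures exactly in its two endpoints, let $H_\gamma\in\mathcal{MCG}(D_n)$ be the positive half twist along $\gamma$. Let $\sigma_i$ be the positive half twist along the segment of the $y$-axis from $p_i$ to $p_{i+1}$, let $\Delta=(\sigma_1\cdots\sigma_{n-1})(\sigma_1\cdots\sigma_{n-2})\cdots(\sigma_1\sigma_2)(\sigma_1)$, and let $\prec$ be Dehornoy's order: $\alpha\prec\beta$ iff, for some $i$, $\alpha^{-1}\beta$ is represented by a word in $\sigma_1^{\pm1},\dots,\sigma_{n-1}^{\pm1}$ that contains $\sigma_i$ but neither $\sigma_i^{-1}$ nor any $\sigma_j^{\pm1}$ with $j<i$. The fractional Dehn twist coefficient of $\varphi$ at the boundary of the disk is $FT(\varphi)=\lim_{N\to\infty}[\varphi^N]_D/N$, where the Dehornoy floor $[\beta]_D$ is the integer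 $k$ with $\Delta^{2k}\preceq\beta\prec\Delta^{2k+2}$. Then for every $m\ge 2$ there exist such arcs $\gamma_1,\dots,\gamma_m$ in $D_n$, each joining two distinct punctures, with $$FT(H_{\gamma_m}\circ\cdots\circ H_{\gamma_1})=m-1 .$$ -/

import Mathlib

namespace PuncturedDisk

/-- The closed unit disk in the plane `ℝ² = ℂ`. -/
abbrev Disk : Type := Metric.closedBall (0 : ℂ) 1

/-- The `y`-coordinate of the `k`-th puncture; the `n` punctures are equally spaced on the
`y`-axis, numbered from bottom to top. -/
noncomputable def height (n : ℕ) (k : ℕ) : ℝ := (2 * (k : ℝ) + 1 - n) / n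

theorem abs_height_lt {n k : ℕ} (hk : k < n) : |height n k| < 1 := by
  have hn : (0 : ℝ) < n := by exact_mod_cast (Nat.zero_le k).trans_lt hk
  have hk' : (k : ℝ) + 1 ≤ n := by exact_mod_cast hk
  have hk0 : (0 : ℝ) ≤ k := Nat.cast_nonneg k
  rw [height, abs_lt]
  constructor
  · rw [lt_div_iff₀ hn]; linarith
  · rw [div_lt_iff₀ hn]; linarith

/-- The punctures (marked points) of `D_n`. -/
noncomputable def puncture (n : ℕ) (k : Fin n) : Disk :=
  ⟨(height n k : ℂ) * Complex.I, by
    have := (abs_height_lt k.2).le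
    simpa using this⟩

/-- The set of punctures of `D_n`. -/
def punctures (n : ℕ) : Set Disk := Set.range (puncture n)

/-! ### The mapping class group of `D_n` -/

/-- The group (under composition) of homeomorphisms of the disk that fix the boundary circle
pointwise and preserve the set of punctures. -/
def HomeoRel (n : ℕ) : Subgroup (Disk ≃ₜ Disk) where
  carrier := {f | (∀ z : Disk, ‖(z : ℂ)‖ = 1 → f z = z) ∧ f '' punctures n = punctures n}
  one_mem' := ⟨fun _ _ => rfl, Set.image_id _⟩
  mul_mem' := by
    rintro f g ⟨hf, hf'⟩ ⟨hg, hg'⟩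
    refine ⟨fun z hz => ?_, ?_⟩
    · rw [Homeomorph.mul_apply, hg z hz, hf z hz]
    · change (f ∘ g) '' _ = _
      rw [Set.image_comp, hg', hf']
  inv_mem' := by
    rintro f ⟨hf, hf'⟩
    refine ⟨fun z hz => ?_, ?_⟩
    · exact (Homeomorph.symm_apply_eq f).2 (hf z hz).symm
    · change f.symm '' _ = _
      conv_lhs => rw [← hf', ← Set.image_comp]
      simp

/-- The homeomorphisms isotopic to the identity, through homeomorphisms that fix the boundary
pointwise and preserve the set of punctures. -/
def isotopicToId (n : ℕ) : Subgroup (HomeoRel n) where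
  carrier := {f | ∃ F : unitInterval → HomeoRel n,
    Continuous (fun p : unitInterval × Disk => (F p.1 : Disk ≃ₜ Disk) p.2) ∧ F 0 = 1 ∧ F 1 = f}
  one_mem' := ⟨fun _ => 1, continuous_snd, rfl, rfl⟩
  mul_mem' := by
    rintro f g ⟨F, hF, hF0, hF1⟩ ⟨G, hG, hG0, hG1⟩
    refine ⟨fun t => F t * G t, ?_, by simp [hF0, hG0], by simp [hF1, hG1]⟩
    exact hF.comp (continuous_fst.prodMk hG)
  inv_mem' := by
    rintro f ⟨F, hF, hF0, hF1⟩
    refine ⟨fun t => (F t)⁻¹, ?_, by simp [hF0], by simp [hF1]⟩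
    let e : unitInterval × Disk ≃ unitInterval × Disk :=
      { toFun := fun p => (p.1, (F p.1 : Disk ≃ₜ Disk) p.2)
        invFun := fun p => (p.1, (F p.1 : Disk ≃ₜ Disk).symm p.2)
        left_inv := fun p => by simp
        right_inv := fun p => by simp }
    have he : Continuous e := continuous_fst.prodMk hF
    exact continuous_snd.comp he.continuous_symm_of_equiv_compact_to_t2

instance isotopicToId_normal (n : ℕ) : (isotopicToId n).Normal where
  conj_mem := by
    rintro f ⟨F, hF, hF0, hF1⟩ g
    refine ⟨fun t => g * F t * g⁻¹, ?_, by simp [hF0], by simp [hF1]⟩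
    exact (g : Disk ≃ₜ Disk).continuous.comp
      (hF.comp (continuous_fst.prodMk
        ((g : Disk ≃ₜ Disk).symm.continuous.comp continuous_snd)))

/-- The mapping class group `MCG(D_n)`, with composition as multiplication. -/
abbrev MCG (n : ℕ) : Type := HomeoRel n ⧸ isotopicToId n

/-! ### Arcs and positive half twists -/

/-- A properly embedded arc in `D_n` joining two (necessarily distinct) punctures: an embedded
arc in the open disk that meets the punctures exactly in its two endpoints. -/
structure PunctureArc (n : ℕ) where
  toFun : unitInterval → Disk
  continuous_toFun : Continuous toFun
  injective_toFun : Function.Injective toFun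
  mem_interior : ∀ t, ‖(toFun t : ℂ)‖ < 1
  mem_punctures_iff : ∀ t, toFun t ∈ punctures n ↔ t = 0 ∨ t = 1

/-- The angle, in units of `π`, by which the model half twist rotates the circle of radius `s`:
it is `1` for `s ≤ r`, it is `0` for `s ≥ R`, and it is affine in between. -/
noncomputable def twistProfile (r R s : ℝ) : ℝ := max 0 (min 1 ((R - s) / (R - r)))

/-- Rotation of the circle of radius `s` around `c` counterclockwise by the angle
`ε π · twistProfile r R s`. -/
noncomputable def twistMap (c : ℂ) (r R ε : ℝ) (z : ℂ) : ℂ :=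
  c + (z - c) * Complex.exp ((ε * Real.pi * twistProfile r R ‖z - c‖ : ℝ) * Complex.I)

theorem norm_twistMap_sub (c : ℂ) (r R ε : ℝ) (z : ℂ) :
    ‖twistMap c r R ε z - c‖ = ‖z - c‖ := by
  simp only [twistMap, add_sub_cancel_left, norm_mul, Complex.norm_exp_ofReal_mul_I, mul_one]

theorem twistMap_neg_twistMap (c : ℂ) (r R ε : ℝ) (z : ℂ) :
    twistMap c r R (-ε) (twistMap c r R ε z) = z := by
  have h := norm_twistMap_sub c r R ε z
  rw [twistMap, h]
  rw [twistMap, add_sub_cancel_left, mul_assoc, ← Complex.exp_add]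
  have : ((ε * Real.pi * twistProfile r R ‖z - c‖ : ℝ) : ℂ) * Complex.I +
      ((-ε * Real.pi * twistProfile r R ‖z - c‖ : ℝ) : ℂ) * Complex.I = 0 := by
    push_cast; ring
  rw [this]; simp

theorem twistMap_of_le {c : ℂ} {r R : ℝ} (hR : r < R) (ε : ℝ) {z : ℂ} (hz : R ≤ ‖z - c‖) :
    twistMap c r R ε z = z := by
  have h : (R - ‖z - c‖) / (R - r) ≤ 0 :=
    div_nonpos_of_nonpos_of_nonneg (by linarith) (by linarith)
  have : twistProfile r R ‖z - c‖ = 0 := by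
    rw [twistProfile, max_eq_left]; exact (min_le_right _ _).trans h
  simp [twistMap, this]

theorem continuous_twistMap (c : ℂ) (r R ε : ℝ) : Continuous (twistMap c r R ε) := by
  unfold twistMap twistProfile
  fun_prop

theorem twistMap_mem {c : ℂ} {r R : ℝ} (hR : r < R) (hc : ‖c‖ + R ≤ 1) (ε : ℝ) (z : Disk) :
    twistMap c r R ε z ∈ Metric.closedBall (0 : ℂ) 1 := by
  rcases le_total R ‖(z : ℂ) - c‖ with h | h
  · rw [twistMap_of_le hR ε h]; exact z.2
  · rw [mem_closedBall_zero_iff]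
    have h1 := norm_twistMap_sub c r R ε z
    have h2 := norm_add_le (twistMap c r R ε z - c) c
    rw [sub_add_cancel] at h2
    linarith

/-- The model positive half twist: it rotates the round disk with centre `c` and radius `r`
counterclockwise by `π`, it is the identity outside the round disk with centre `c` and radius `R`,
and an arc entering the annulus in between from outside is turned to the right. -/
noncomputable def modelHalfTwist (c : ℂ) (r R : ℝ) (hR : r < R) (hc : ‖c‖ + R ≤ 1) :
    Disk ≃ₜ Disk where
  toFun z := ⟨twistMap c r R 1 z, twistMap_mem hR hc 1 z⟩
  invFun z := ⟨twistMap c r R (-1) z, twistMap_mem hR hc (-1) z⟩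
  left_inv z := Subtype.ext (twistMap_neg_twistMap c r R 1 z)
  right_inv z := Subtype.ext (by
    have := twistMap_neg_twistMap c r R (-1) z
    rwa [neg_neg] at this)
  continuous_toFun :=
    ((continuous_twistMap c r R 1).comp continuous_subtype_val).subtype_mk _
  continuous_invFun :=
    ((continuous_twistMap c r R (-1)).comp continuous_subtype_val).subtype_mk _

/-- `IsHalfTwist γ H` says that the mapping class `H` is the positive half twist `H_γ` along `γ`.
Here `g` is a homeomorphism of the disk fixing the boundary (hence orientation preserving),
`g (closedBall c R)` is a regular neighbourhood of `γ` that contains no punctures other than the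
endpoints of `γ`, the arc `γ` is the image of the vertical diameter of the round disk with
centre `c` and radius `r`, and `H` is represented by the model half twist transported by `g`.
By the classical uniqueness of such neighbourhoods up to isotopy, this determines the mapping
class `H` from `γ`. -/
def IsHalfTwist {n : ℕ} (γ : PunctureArc n) (H : MCG n) : Prop :=
  ∃ (g : Disk ≃ₜ Disk) (c : ℂ) (r R : ℝ) (hR : r < R) (hc : ‖c‖ + R < 1) (h : HomeoRel n),
    0 < r ∧
    (∀ z : Disk, ‖(z : ℂ)‖ = 1 → g z = z) ∧
    Set.range γ.toFun =
      g '' {z : Disk | ∃ t ∈ Set.Icc (-r) r, (z : ℂ) = c + (t : ℂ) * Complex.I} ∧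
    (∀ z : Disk, ‖(z : ℂ) - c‖ ≤ R → g z ∈ punctures n →
      g z = γ.toFun 0 ∨ g z = γ.toFun 1) ∧
    (h : Disk ≃ₜ Disk) = g * modelHalfTwist c r R hR hc.le * g⁻¹ ∧
    (QuotientGroup.mk h : MCG n) = H

/-! ### The standard generators -/

/-- The midpoint of the segment `ρ_i` of the `y`-axis from the puncture with index `i` to
the puncture with index `i + 1`. -/
noncomputable def midpt (n : ℕ) (i : ℕ) : ℂ :=
  (((2 * (i : ℝ) + 2 - n) / n : ℝ) : ℂ) * Complex.I

theorem pos_of_fin {n : ℕ} (i : Fin (n - 1)) : (0 : ℝ) < n := by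
  have := i.2
  exact_mod_cast (show 0 < n by omega)

theorem radius_lt {n : ℕ} (i : Fin (n - 1)) : 1 / (n : ℝ) < 3 / 2 / (n : ℝ) :=
  div_lt_div_of_pos_right (by norm_num) (pos_of_fin i)

theorem norm_midpt_le {n : ℕ} (i : Fin (n - 1)) : ‖midpt n i‖ + 2 / n ≤ 1 := by
  have hn := pos_of_fin i
  have hi : (i : ℝ) + 2 ≤ n := by
    have := i.2
    exact_mod_cast (show (i : ℕ) + 2 ≤ n by omega)
  have hi0 : (0 : ℝ) ≤ (i : ℕ) := Nat.cast_nonneg _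
  have h : ‖midpt n i‖ ≤ 1 - 2 / n := by
    rw [midpt, norm_mul, Complex.norm_I, mul_one, Complex.norm_real, Real.norm_eq_abs, abs_le]
    constructor
    · rw [← sub_nonneg]; field_simp; linarith
    · rw [← sub_nonneg]; field_simp; linarith
  linarith

theorem norm_midpt_add_radius_lt {n : ℕ} (i : Fin (n - 1)) :
    ‖midpt n i‖ + 3 / 2 / (n : ℝ) < 1 := by
  have h1 := norm_midpt_le i
  have h2 : 3 / 2 / (n : ℝ) < 2 / n := div_lt_div_of_pos_right (by norm_num) (pos_of_fin i)
  linarith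

/-- The positive half twist along the segment `ρ_i` of the `y`-axis, as a homeomorphism. -/
noncomputable def sigmaHomeo (n : ℕ) (i : Fin (n - 1)) : Disk ≃ₜ Disk :=
  modelHalfTwist (midpt n i) (1 / n) (3 / 2 / n) (radius_lt i) (norm_midpt_add_radius_lt i).le

theorem puncture_sub_midpt {n : ℕ} (i : Fin (n - 1)) (k : Fin n) :
    (puncture n k : ℂ) - midpt n i = (((2 * ((k : ℝ) - i) - 1) / n : ℝ) : ℂ) * Complex.I := by
  simp only [puncture, height, midpt]
  push_cast
  ring

theorem norm_puncture_sub_midpt {n : ℕ} (i : Fin (n - 1)) (k : Fin n) :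
    ‖(puncture n k : ℂ) - midpt n i‖ = |2 * ((k : ℝ) - i) - 1| / n := by
  rw [puncture_sub_midpt, norm_mul, Complex.norm_I, mul_one, Complex.norm_real, Real.norm_eq_abs,
    abs_div, abs_of_pos (pos_of_fin i)]

theorem twistMap_of_eq {c : ℂ} {r R : ℝ} (hR : r < R) {z : ℂ} (hz : ‖z - c‖ = r) :
    twistMap c r R 1 z = c - (z - c) := by
  have h : twistProfile r R ‖z - c‖ = 1 := by
    rw [twistProfile, hz, div_self (by linarith)]; simp
  rw [twistMap, h, one_mul, mul_one, Complex.exp_pi_mul_I]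
  ring

theorem sigmaHomeo_puncture_mem {n : ℕ} (i : Fin (n - 1)) (k : Fin n) :
    sigmaHomeo n i (puncture n k) ∈ punctures n := by
  have hn := pos_of_fin i
  have hi := i.2
  have key : ∀ k' : Fin n, ((k : ℝ) - i - 1 = -((k' : ℝ) - i)) →
      ‖(puncture n k : ℂ) - midpt n i‖ = 1 / n →
      sigmaHomeo n i (puncture n k) ∈ punctures n := by
    intro k' hk' hr
    refine ⟨k', Subtype.ext ?_⟩
    change _ = twistMap (midpt n i) (1 / n) (3 / 2 / n) 1 (puncture n k)
    have h' : (puncture n k' : ℂ) - midpt n i = -((puncture n k : ℂ) - midpt n i) := by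
      rw [puncture_sub_midpt, puncture_sub_midpt, ← neg_mul, ← Complex.ofReal_neg, ← neg_div]
      congr 3
      linarith
    rw [twistMap_of_eq (radius_lt i) hr, sub_eq_add_neg, ← h']
    ring
  by_cases h1 : (k : ℕ) = i
  · refine key ⟨i + 1, by omega⟩ ?_ ?_
    · push_cast; rw [h1]; ring
    · rw [norm_puncture_sub_midpt, h1]; norm_num
  by_cases h2 : (k : ℕ) = i + 1
  · refine key ⟨i, by omega⟩ ?_ ?_
    · rw [h2]; push_cast; ring
    · rw [norm_puncture_sub_midpt, h2]; push_cast; norm_num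
  refine ⟨k, Subtype.ext ?_⟩
  change _ = twistMap (midpt n i) (1 / n) (3 / 2 / n) 1 (puncture n k)
  rw [twistMap_of_le (radius_lt i)]
  rw [norm_puncture_sub_midpt]
  refine div_le_div_of_nonneg_right ?_ hn.le
  have h3 : (k : ℕ) + 1 ≤ i ∨ (i : ℕ) + 2 ≤ k := by omega
  rcases h3 with h3 | h3
  · have : (k : ℝ) + 1 ≤ (i : ℕ) := by exact_mod_cast h3
    exact le_trans (by linarith) (neg_le_abs _)
  · have : ((i : ℕ) : ℝ) + 2 ≤ k := by exact_mod_cast h3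
    exact le_trans (by linarith) (le_abs_self _)

theorem sigmaHomeo_mem (n : ℕ) (i : Fin (n - 1)) : sigmaHomeo n i ∈ HomeoRel n := by
  refine ⟨fun z hz => Subtype.ext (twistMap_of_le (radius_lt i) 1 ?_), ?_⟩
  · have h1 := norm_midpt_add_radius_lt i
    have h2 := norm_sub_norm_le (z : ℂ) (midpt n i)
    linarith
  · refine Set.eq_of_subset_of_ncard_le ?_ ?_ (Set.finite_range _)
    · rintro _ ⟨_, ⟨k, rfl⟩, rfl⟩
      exact sigmaHomeo_puncture_mem i k
    · rw [Set.ncard_image_of_injective _ (sigmaHomeo n i).injective]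

/-- The standard generator `σ_i` (indices start from `0`): the class of the positive half twist
along `ρ_i`. -/
noncomputable def sigma {n : ℕ} (i : Fin (n - 1)) : MCG n :=
  QuotientGroup.mk (⟨sigmaHomeo n i, sigmaHomeo_mem n i⟩ : HomeoRel n)

/-! ### Dehornoy's order, Dehornoy's floor, and the fractional Dehn twist coefficient -/

/-- The value in `MCG(D_n)` of a letter of a braid word: `(i, true)` stands for `σ_i` and
`(i, false)` for `σ_i⁻¹`. -/
noncomputable def letter {n : ℕ} (x : Fin (n - 1) × Bool) : MCG n :=
  if x.2 then sigma x.1 else (sigma x.1)⁻¹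

/-- `β ≻ 1` in Dehornoy's order: for some `i`, the braid `β` is represented by a word that
contains `σ_i`, but neither `σ_i⁻¹` nor any `σ_j^{±1}` with `j < i`. -/
def SigmaPositive {n : ℕ} (β : MCG n) : Prop :=
  ∃ (i : Fin (n - 1)) (w : List (Fin (n - 1) × Bool)),
    (i, true) ∈ w ∧ (i, false) ∉ w ∧ (∀ x ∈ w, i ≤ x.1) ∧ (w.map letter).prod = β

/-- Dehornoy's order: `α ≺ β` iff `α⁻¹ β ≻ 1`. -/
def DehornoyLT {n : ℕ} (α β : MCG n) : Prop := SigmaPositive (α⁻¹ * β)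

/-- `α ⪯ β` iff `α = β` or `α ≺ β`. -/
def DehornoyLE {n : ℕ} (α β : MCG n) : Prop := α = β ∨ DehornoyLT α β

/-- The Garside element `Δ = (σ_1 ⋯ σ_{n-1}) (σ_1 ⋯ σ_{n-2}) ⋯ (σ_1 σ_2) (σ_1)`, whose square is
the full twist, i.e. the positive Dehn twist about the boundary. -/
noncomputable def garside (n : ℕ) : MCG n :=
  ((List.finRange (n - 1)).reverse.map fun k =>
    (((List.finRange (n - 1)).filter (· ≤ k)).map sigma).prod).prod

/-- `k` is the Dehornoy floor of `β`: `Δ^{2k} ⪯ β ≺ Δ^{2k+2}`. -/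
def IsDehornoyFloor {n : ℕ} (β : MCG n) (k : ℤ) : Prop :=
  DehornoyLE (garside n ^ (2 * k)) β ∧ DehornoyLT β (garside n ^ (2 * k + 2))

/-- `HasFDTC φ x` says that `x` is the fractional Dehn twist coefficient `FT(φ)` of `φ` at the
boundary of the disk: `x = lim_{N → ∞} [φ^N] / N`, where `[·]` is the Dehornoy floor. -/
def HasFDTC {n : ℕ} (φ : MCG n) (x : ℝ) : Prop :=
  ∃ fl : ℕ → ℤ, (∀ N, IsDehornoyFloor (φ ^ N) (fl N)) ∧
    Filter.Tendsto (fun N : ℕ => (fl N : ℝ) / N) Filter.atTop (nhds x)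

end PuncturedDisk

namespace PuncturedDisk

/-! ### Isotopies of the disk -/

/-! The choice of arcs is algebraic. Write s₀, s₁, … for the standard generators and z = Δ² for the
central full twist. The engine is a factorization z = s₀ U s₀ s₁ V with U, V positive words avoiding
s₀ (`BraidRel.exists_fullTwist_eq`). With Y = U s₁, the braid relation turns it into V s₀ Y s₀ = z
s₀ s₁⁻¹: one more s₀ buys a full twist, at the price of letters other than s₀. Inductively, a
product of m conjugates of s₀ equals z^(m-1) x, where x = s₀ c⁻¹ and c is a positive word avoiding
s₀ (`BraidRel.exists_prod_conj_eq`). Each conjugate is a positive half twist along an image of the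
bottom segment (`exists_isHalfTwist_conj`).

The N-th power has Dehornoy floor exactly (m-1)N, because 1 ⪯ x^N ≺ Δ²
(`hasFDTC_fullTwist_pow_mul`). The lower bound holds since x^N contains s₀ and no s₀⁻¹ when N > 0.
For the upper bound, x^(-N) Δ² = Δ (Δ x⁻¹ Δ⁻¹)^N Δ; conjugation by Δ reverses the order of the
generators, so the middle factor inverts only the last generator, which differs from s₀ as n ≥ 3.

All this needs the braid relations between actual mapping classes. An isotopy from the identity
determines its final class by the motion of the punctures, up to collision-free homotopy
(`exists_isotopy_of_homotopy`). Both sides of the braid relation move three neighbouring punctures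
by motions that are straight-line homotopic to one rigid half rotation (`mk_threeTwists`). -/

/-- Joint continuity of a family of homeomorphisms of the disk. -/
def IsIsotopy (F : unitInterval → Disk ≃ₜ Disk) : Prop :=
  Continuous fun p : unitInterval × Disk => F p.1 p.2

theorem IsIsotopy.mul {F G : unitInterval → Disk ≃ₜ Disk} (hF : IsIsotopy F) (hG : IsIsotopy G) :
    IsIsotopy fun t => F t * G t :=
  Continuous.comp hF (continuous_fst.prodMk hG)

/-- The level-preserving bijection of the compact Hausdorff space `I × Disk` is continuous, hence so
is its inverse. -/
theorem IsIsotopy.inv {F : unitInterval → Disk ≃ₜ Disk} (hF : IsIsotopy F) :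
    IsIsotopy fun t => (F t)⁻¹ := by
  let e : unitInterval × Disk ≃ unitInterval × Disk :=
    { toFun := fun p => (p.1, F p.1 p.2)
      invFun := fun p => (p.1, (F p.1).symm p.2)
      left_inv := fun p => by simp
      right_inv := fun p => by simp }
  have he : Continuous e := continuous_fst.prodMk hF
  exact continuous_snd.comp he.continuous_symm_of_equiv_compact_to_t2

theorem norm_lt_one_of_fix_boundary {f : Disk ≃ₜ Disk} (hf : ∀ z : Disk, ‖(z : ℂ)‖ = 1 → f z = z)
    {z : Disk} (hz : ‖(z : ℂ)‖ < 1) : ‖(f z : ℂ)‖ < 1 := by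
  refine lt_of_le_of_ne (mem_closedBall_zero_iff.1 (f z).2) fun h => ?_
  have := f.injective (hf _ h)
  rw [this] at h
  exact hz.ne h

theorem norm_puncture_lt (n : ℕ) (k : Fin n) : ‖(puncture n k : ℂ)‖ < 1 := by
  simpa [puncture] using abs_height_lt k.2

theorem puncture_injective (n : ℕ) : Function.Injective (puncture n) := by
  intro i j hij
  have hn : (0 : ℝ) < n := by exact_mod_cast i.pos
  have h : ((height n i : ℝ) : ℂ) * Complex.I = (height n j : ℝ) * Complex.I :=
    congrArg Subtype.val hij
  have h' : height n i = height n j := by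
    exact_mod_cast mul_right_cancel₀ Complex.I_ne_zero h
  rw [height, height, div_left_inj' hn.ne'] at h'
  have : ((i : ℕ) : ℝ) = (j : ℕ) := by linarith
  exact Fin.ext (by exact_mod_cast this)

/-! ### Pushing finitely many points -/

/-- The map of the plane that pushes the points `x j` to the points `y j`, with support in the
balls of radius `r` around the points `x j`. -/
noncomputable def pushMap {n : ℕ} (r : ℝ) (x y : Fin n → ℂ) (z : ℂ) : ℂ :=
  z + ∑ j, ((max 0 (1 - ‖z - x j‖ / r) : ℝ) : ℂ) * (y j - x j)

section push

variable {n : ℕ} {r η : ℝ} {x y : Fin n → ℂ}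

theorem bump_eq_zero (hr : 0 < r) {z w : ℂ} (h : r ≤ ‖z - w‖) : max 0 (1 - ‖z - w‖ / r) = 0 := by
  rw [max_eq_left]
  rw [sub_nonpos, le_div_iff₀ hr]
  linarith

theorem pushMap_of_far (hr : 0 < r) {z : ℂ} (h : ∀ j, r ≤ ‖z - x j‖) : pushMap r x y z = z := by
  simp [pushMap, bump_eq_zero hr (h _)]

theorem pushMap_self (r : ℝ) (x : Fin n → ℂ) (z : ℂ) : pushMap r x x z = z := by
  simp [pushMap]

theorem pushMap_apply (hr : 0 < r) (i : Fin n) (h : ∀ j, i ≠ j → r ≤ ‖x i - x j‖) :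
    pushMap r x y (x i) = y i := by
  rw [pushMap, Finset.sum_eq_single i]
  · simp
  · intro j _ hj
    rw [bump_eq_zero hr (h j hj.symm)]
    simp
  · simp

/-- Each of the `n` tent functions is `1/r`-Lipschitz and multiplies a displacement of size at most
`η`. -/
theorem approximatesLinearOn_pushMap (hr : 0 < r) (hη : 0 ≤ η) (hxy : ∀ j, ‖y j - x j‖ ≤ η) :
    ApproximatesLinearOn (pushMap r x y) ((ContinuousLinearEquiv.refl ℝ ℂ : ℂ ≃L[ℝ] ℂ) : ℂ →L[ℝ] ℂ)
      Set.univ (n * η / r).toNNReal := by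
  intro z _ w _
  have e : pushMap r x y z - pushMap r x y w -
      ((ContinuousLinearEquiv.refl ℝ ℂ : ℂ ≃L[ℝ] ℂ) : ℂ →L[ℝ] ℂ) (z - w) =
      ∑ j, ((max 0 (1 - ‖z - x j‖ / r) - max 0 (1 - ‖w - x j‖ / r) : ℝ) : ℂ) * (y j - x j) := by
    simp only [pushMap, Complex.ofReal_sub, sub_mul, Finset.sum_sub_distrib]
    simp
    ring
  rw [e, Real.coe_toNNReal _ (by positivity)]
  refine (norm_sum_le _ _).trans ((Finset.sum_le_card_nsmul _ _ (‖z - w‖ / r * η) ?_).trans_eq ?_)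
  · intro j _
    rw [norm_mul, Complex.norm_real, Real.norm_eq_abs]
    refine mul_le_mul ?_ (hxy j) (norm_nonneg _) (by positivity)
    refine (abs_max_sub_max_le_max _ _ _ _).trans (max_le (by simp; positivity) ?_)
    have h1 : 1 - ‖z - x j‖ / r - (1 - ‖w - x j‖ / r) = (‖w - x j‖ - ‖z - x j‖) / r := by ring
    rw [h1, abs_div, abs_of_pos hr]
    refine div_le_div_of_nonneg_right ?_ hr.le
    refine (abs_norm_sub_norm_le _ _).trans_eq ?_
    rw [sub_sub_sub_cancel_right, norm_sub_rev]
  · simp only [Finset.card_univ, Fintype.card_fin, nsmul_eq_mul]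
    ring

/-- A perturbation of the identity with Lipschitz constant below 1 is a homeomorphism of the plane.
It fixes everything on or outside the unit circle, so it restricts to the disk. -/
theorem exists_pushHomeo (hr : 0 < r) (hη : 0 ≤ η) (hηr : n * η < r)
    (hxy : ∀ j, ‖y j - x j‖ ≤ η) (hx : ∀ j, ‖x j‖ + r ≤ 1) :
    ∃ h : Disk ≃ₜ Disk, ∀ z : Disk, (h z : ℂ) = pushMap r x y z := by
  have hfix : ∀ z : ℂ, 1 ≤ ‖z‖ → pushMap r x y z = z := fun z hz =>
    pushMap_of_far hr fun j => by
      have := norm_sub_norm_le z (x j)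
      linarith [hx j]
  have hc : Subsingleton ℂ ∨ (n * η / r).toNNReal <
      ‖(((ContinuousLinearEquiv.refl ℝ ℂ).symm : ℂ ≃L[ℝ] ℂ) : ℂ →L[ℝ] ℂ)‖₊⁻¹ := by
    right
    have : ‖(((ContinuousLinearEquiv.refl ℝ ℂ).symm : ℂ ≃L[ℝ] ℂ) : ℂ →L[ℝ] ℂ)‖₊ = 1 := by
      have : (((ContinuousLinearEquiv.refl ℝ ℂ).symm : ℂ ≃L[ℝ] ℂ) : ℂ →L[ℝ] ℂ)
        = ContinuousLinearMap.id ℝ ℂ := rfl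
      rw [this, ← NNReal.coe_inj, coe_nnnorm, ContinuousLinearMap.norm_id]
      rfl
    rw [this, inv_one, Real.toNNReal_lt_one, div_lt_one hr]
    exact hηr
  let H : ℂ ≃ₜ ℂ := (approximatesLinearOn_pushMap hr hη hxy).toHomeomorph _ hc
  have hH : ∀ z, H z = pushMap r x y z := fun _ => rfl
  refine ⟨H.subtype fun z => ?_, fun z => hH z⟩
  rw [mem_closedBall_zero_iff, mem_closedBall_zero_iff]
  constructor
  · intro hz
    by_contra hlt
    have h1 : H (H z) = H z := hfix _ (not_le.1 hlt).le
    rw [H.injective h1] at hlt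
    exact hlt hz
  · intro hz
    by_contra hlt
    have h1 : H z = z := hfix _ (not_le.1 hlt).le
    rw [h1] at hz
    exact hlt hz

end push

/-! ### Mapping classes and motions of the punctures -/

theorem eventually_le_of_pos {X : Type*} [TopologicalSpace X] [CompactSpace X] {φ : X → ℝ}
    (hφ : Continuous φ) (h : ∀ p, 0 < φ p) : ∀ᶠ r in nhdsWithin (0 : ℝ) (Set.Ioi 0), ∀ p, r ≤ φ p := by
  obtain ⟨a, ha, h'⟩ := isCompact_univ.exists_forall_le' hφ.continuousOn fun p _ => h p
  filter_upwards [Ioo_mem_nhdsGT ha] with r hr p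
  exact hr.2.le.trans (h' p trivial)

open unitInterval in
/-- The mapping class at the end of an isotopy of the disk that starts at the identity depends on
the motion of the punctures only up to homotopies through motions without collisions. -/
theorem exists_isotopy_of_homotopy {n : ℕ} {x : I × I → Fin n → ℂ} (hx : Continuous x)
    (hx1 : ∀ p j, ‖x p j‖ < 1) (hxi : ∀ p i j, i ≠ j → x p i ≠ x p j)
    (hx_zero : ∀ s, x (s, 0) = x (0, 0)) (hx_one : ∀ s, x (s, 1) = x (0, 1))
    {F : I → Disk ≃ₜ Disk} (hF : IsIsotopy F) (F_zero : F 0 = 1)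
    (hFb : ∀ t, ∀ z : Disk, ‖(z : ℂ)‖ = 1 → F t z = z)
    (hFx : ∀ t j, (F t (puncture n j) : ℂ) = x (0, t) j) :
    ∃ G : I → Disk ≃ₜ Disk, IsIsotopy G ∧ G 0 = 1 ∧ G 1 = F 1 ∧
      (∀ t, ∀ z : Disk, ‖(z : ℂ)‖ = 1 → G t z = z) ∧
      ∀ t j, (G t (puncture n j) : ℂ) = x (1, t) j := by
  obtain ⟨r, ⟨hr1, hr2⟩, hr⟩ : ∃ r, ((∀ j p, r ≤ 1 - ‖x p j‖) ∧
      ∀ i j, i ≠ j → ∀ p, r ≤ ‖x p i - x p j‖) ∧ r ∈ Set.Ioi (0 : ℝ) := by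
    have h1 : ∀ᶠ r in nhdsWithin (0 : ℝ) (Set.Ioi 0), ∀ j p, r ≤ 1 - ‖x p j‖ :=
      Filter.eventually_all.2 fun j =>
        eventually_le_of_pos (by fun_prop) fun p => by linarith [hx1 p j]
    have h2 : ∀ᶠ r in nhdsWithin (0 : ℝ) (Set.Ioi 0),
        ∀ i j, i ≠ j → ∀ p, r ≤ ‖x p i - x p j‖ := by
      refine Filter.eventually_all.2 fun i => Filter.eventually_all.2 fun j => ?_
      by_cases hij : i = j
      · simp [hij]
      · simpa [hij] using eventually_le_of_pos (φ := fun p => ‖x p i - x p j‖) (by fun_prop)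
          fun p => norm_pos_iff.2 (sub_ne_zero.2 (hxi p i j hij))
    exact ((h1.and h2).and self_mem_nhdsWithin).exists
  rw [Set.mem_Ioi] at hr
  -- The `n + 1` makes `n * η < r`, the condition for a push by at most `η` to be a homeomorphism.
  set η : ℝ := r / (n + 1) with hη_def
  have hη : 0 < η := by positivity
  have hηr : n * η < r := by
    rw [hη_def, ← mul_div_assoc, div_lt_iff₀ (by positivity)]
    nlinarith
  obtain ⟨δ, hδ, hδ'⟩ := Metric.uniformContinuous_iff.1
    (CompactSpace.uniformContinuous_of_continuous hx) η hη
  let P : I → I → Prop := fun s s' =>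
    (∃ G : I → Disk ≃ₜ Disk, IsIsotopy G ∧ G 0 = 1 ∧ G 1 = F 1 ∧
      (∀ t, ∀ z : Disk, ‖(z : ℂ)‖ = 1 → G t z = z) ∧
      ∀ t j, (G t (puncture n j) : ℂ) = x (s, t) j) →
    (∃ G : I → Disk ≃ₜ Disk, IsIsotopy G ∧ G 0 = 1 ∧ G 1 = F 1 ∧
      (∀ t, ∀ z : Disk, ‖(z : ℂ)‖ = 1 → G t z = z) ∧
      ∀ t j, (G t (puncture n j) : ℂ) = x (s', t) j)
  -- For nearby parameters, compose with the push from `x (s, t)` to `x (s', t)`. At `t = 0` and `t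
  -- = 1` the positions do not depend on `s`, so the push is the identity and both ends of the
  -- isotopy survive.
  have step : ∀ s s', dist s s' < δ → P s s' := by
    rintro s s' hs ⟨G, hG, hG0, hG1, hGb, hGx⟩
    have hxy : ∀ t j, ‖x (s', t) j - x (s, t) j‖ ≤ η := fun t j => by
      rw [← dist_eq_norm, dist_comm]
      refine (dist_le_pi_dist (x (s, t)) (x (s', t)) j).trans (hδ' ?_).le
      simpa [Prod.dist_eq, hδ] using hs
    have hex := fun t => exists_pushHomeo hr hη.le hηr (hxy t) fun j => by
      linarith [hr1 j (s, t)]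
    choose h hh using hex
    have h_id : ∀ t, x (s', t) = x (s, t) → h t = 1 := fun t ht => by
      ext z
      rw [hh, ht, pushMap_self]
      rfl
    have hcont : IsIsotopy h := by
      refine Continuous.subtype_mk (f := fun p : I × Disk => (h p.1 p.2 : ℂ)) ?_ _
      simp only [hh, pushMap]
      fun_prop
    refine ⟨fun t => h t * G t, hcont.mul hG, ?_, ?_, fun t z hz => ?_, fun t j => ?_⟩
    · simp only [hG0, mul_one]
      exact h_id 0 ((hx_zero _).trans (hx_zero _).symm)
    · simp only [hG1]
      rw [h_id 1 ((hx_one _).trans (hx_one _).symm), one_mul]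
    · rw [Homeomorph.mul_apply, hGb t z hz]
      refine Subtype.ext ((hh t z).trans (pushMap_of_far hr fun j => ?_))
      have := norm_sub_norm_le (z : ℂ) (x (s, t) j)
      linarith [hr1 j (s, t)]
    · rw [Homeomorph.mul_apply, hh, hGx]
      exact pushMap_apply hr j fun i hi => hr2 j i hi _
  -- `P` is transitive and holds in both directions between nearby parameters; connectedness of the
  -- interval does the rest.
  have hP : P 0 1 := by
    refine PreconnectedSpace.induction₂' P (fun s => ?_) ⟨fun _ _ _ h1 h2 h => h2 (h1 h)⟩ 0 1
    filter_upwards [Metric.ball_mem_nhds s hδ] with s' hs'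
    exact ⟨step _ _ (by rwa [dist_comm]), step _ _ hs'⟩
  exact hP ⟨F, hF, F_zero, rfl, hFb, hFx⟩

open unitInterval in
/-- Two motions of the punctures that are joined by a straight-line homotopy without collisions
give rise to the same mapping class. -/
theorem mk_eq_mk_of_segment {n : ℕ} {F G : I → Disk ≃ₜ Disk} (hF : IsIsotopy F)
    (hG : IsIsotopy G) (F_zero : F 0 = 1) (G_zero : G 0 = 1)
    (hFb : ∀ t, ∀ z : Disk, ‖(z : ℂ)‖ = 1 → F t z = z)
    (hGb : ∀ t, ∀ z : Disk, ‖(z : ℂ)‖ = 1 → G t z = z) {f g : HomeoRel n}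
    (hf : F 1 = f) (hg : G 1 = g)
    (hfg : ∀ j, F 1 (puncture n j) = G 1 (puncture n j))
    (hne : ∀ t i j, i ≠ j → (0 : ℂ) ∉ segment ℝ
      ((F t (puncture n i) : ℂ) - F t (puncture n j))
      ((G t (puncture n i) : ℂ) - G t (puncture n j))) :
    (QuotientGroup.mk f : MCG n) = QuotientGroup.mk g := by
  have hFc : ∀ j, Continuous fun t => (F t (puncture n j) : ℂ) := fun j =>
    continuous_subtype_val.comp (Continuous.comp hF (continuous_id.prodMk continuous_const))
  have hGc : ∀ j, Continuous fun t => (G t (puncture n j) : ℂ) := fun j =>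
    continuous_subtype_val.comp (Continuous.comp hG (continuous_id.prodMk continuous_const))
  let x : I × I → Fin n → ℂ := fun p j =>
    (1 - (p.1 : ℝ)) • (F p.2 (puncture n j) : ℂ) + (p.1 : ℝ) • (G p.2 (puncture n j) : ℂ)
  have hx : Continuous x := by
    refine continuous_pi fun j => ?_
    have h1 := (hFc j).comp (continuous_snd : Continuous fun p : I × I => p.2)
    have h2 := (hGc j).comp (continuous_snd : Continuous fun p : I × I => p.2)
    simp only [Function.comp_def] at h1 h2
    fun_prop
  have hx1 : ∀ p j, ‖x p j‖ < 1 := fun p j => by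
    have h1 := norm_lt_one_of_fix_boundary (hFb p.2) (norm_puncture_lt n j)
    have h2 := norm_lt_one_of_fix_boundary (hGb p.2) (norm_puncture_lt n j)
    rw [← mem_ball_zero_iff] at h1 h2 ⊢
    exact convex_ball (0 : ℂ) 1 h1 h2 (sub_nonneg.2 p.1.2.2) p.1.2.1 (sub_add_cancel _ _)
  have hxi : ∀ p i j, i ≠ j → x p i ≠ x p j := fun p i j hij h => by
    refine hne p.2 i j hij
      ⟨1 - (p.1 : ℝ), p.1, sub_nonneg.2 p.1.2.2, p.1.2.1, sub_add_cancel _ _, ?_⟩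
    simp only [x] at h
    rw [smul_sub, smul_sub, sub_add_sub_comm, h, sub_self]
  obtain ⟨H, hH, H_zero, hH1, hHb, hHx⟩ := exists_isotopy_of_homotopy hx hx1 hxi
    (fun s => by ext j; simp only [x, F_zero, G_zero, ← add_smul]; simp)
    (fun s => by ext j; simp only [x, hfg]; rw [← add_smul]; simp)
    hF F_zero hFb (fun t j => by simp [x])
  -- `H` ends at `f` but moves the punctures as `G` does, so `(G t)⁻¹ * H t` fixes every puncture
  -- throughout and is an admissible isotopy from `1` to `g⁻¹ * f`.
  have key : ∀ t j, (G t)⁻¹ (H t (puncture n j)) = puncture n j := fun t j => by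
    have : H t (puncture n j) = G t (puncture n j) := Subtype.ext (by rw [hHx]; simp [x])
    rw [this]
    exact (G t).symm_apply_apply _
  have hmem : ∀ t, (G t)⁻¹ * H t ∈ HomeoRel n := by
    refine fun t => ⟨fun z hz => ?_, ?_⟩
    · rw [Homeomorph.mul_apply, hHb t z hz]
      exact (G t).symm_apply_eq.2 (hGb t z hz).symm
    · rw [punctures, ← Set.range_comp]
      exact congrArg Set.range (funext fun j => key t j)
  refine Eq.symm ?_
  rw [QuotientGroup.eq]
  refine ⟨fun t => ⟨_, hmem t⟩, hG.inv.mul hH, Subtype.ext ?_, Subtype.ext ?_⟩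
  · simp [G_zero, H_zero]
  · simp [hH1, hf, hg]

/-! ### Pairs of complex numbers in a common open half plane -/

/-- The two complex numbers lie in a common open half plane bounded by a line through `0`. -/
def InHalfPlane (u v : ℂ) : Prop := ∃ μ : ℂ, 0 < (u * μ).re ∧ 0 < (v * μ).re

/-- An open half plane is convex and omits 0. Applied to differences of positions, this rules out
collisions in a straight-line homotopy. -/
theorem InHalfPlane.zero_notMem_segment {u v : ℂ} (h : InHalfPlane u v) :
    (0 : ℂ) ∉ segment ℝ u v := by
  obtain ⟨μ, hu, hv⟩ := h
  rintro ⟨a, b, ha, hb, hab, h0⟩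
  have h1 := congrArg (fun x : ℂ => (x * μ).re) h0
  simp only [add_mul, smul_mul_assoc, Complex.add_re, Complex.smul_re, zero_mul, Complex.zero_re,
    smul_eq_mul] at h1
  rcases ha.eq_or_lt with rfl | ha
  · have : b = 1 := by linarith
    subst this
    linarith
  · nlinarith [mul_pos ha hu, mul_nonneg hb hv.le]

theorem InHalfPlane.neg {u v : ℂ} (h : InHalfPlane u v) : InHalfPlane (-u) (-v) := by
  obtain ⟨μ, hu, hv⟩ := h
  exact ⟨-μ, by rwa [neg_mul_neg], by rwa [neg_mul_neg]⟩

theorem InHalfPlane.mul_left {u v w : ℂ} (h : InHalfPlane u v) (hw : w ≠ 0) :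
    InHalfPlane (w * u) (w * v) := by
  obtain ⟨μ, hu, hv⟩ := h
  refine ⟨w⁻¹ * μ, ?_, ?_⟩
  · rwa [show w * u * (w⁻¹ * μ) = u * μ by field_simp]
  · rwa [show w * v * (w⁻¹ * μ) = v * μ by field_simp]

theorem inHalfPlane_self {u : ℂ} (h : u ≠ 0) : InHalfPlane u u := by
  have : 0 < (u * u⁻¹).re := by rw [mul_inv_cancel₀ h]; simp
  exact ⟨u⁻¹, this, this⟩

/-- Seen from `p`, the ball of radius `2 * ρ` about `q` lies in the half plane around the direction
of `q - p`. -/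
theorem inHalfPlane_of_far {q x y p : ℂ} {ρ : ℝ} (hρ : 0 < ρ) (hx : ‖x - q‖ ≤ 2 * ρ)
    (hy : ‖y - q‖ ≤ 2 * ρ) (hp : 4 * ρ ≤ ‖p - q‖) : InHalfPlane (x - p) (y - p) := by
  have key : ∀ x : ℂ, ‖x - q‖ ≤ 2 * ρ → 0 < ((x - p) * (q - p)⁻¹).re := by
    intro x hx
    have h0 : q - p ≠ 0 := by
      rw [← norm_pos_iff, norm_sub_rev]
      linarith
    have e : (x - p) * (q - p)⁻¹ = 1 + (x - q) * (q - p)⁻¹ := by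
      field_simp
      ring
    have h1 : ‖(x - q) * (q - p)⁻¹‖ < 1 := by
      rw [norm_mul, norm_inv, norm_sub_rev q p, ← div_eq_mul_inv, div_lt_one (by linarith)]
      linarith
    have h2 := (abs_le.1 (Complex.abs_re_le_norm ((x - q) * (q - p)⁻¹))).1
    rw [e, Complex.add_re, Complex.one_re]
    linarith
  exact ⟨_, key x hx, key y hy⟩

/-- The point of the unit circle with argument `θ π`. -/
noncomputable def cis (θ : ℝ) : ℂ := Complex.exp ((θ * Real.pi : ℝ) * Complex.I)

theorem norm_cis (θ : ℝ) : ‖cis θ‖ = 1 := Complex.norm_exp_ofReal_mul_I _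

theorem cis_add (θ φ : ℝ) : cis (θ + φ) = cis θ * cis φ := by
  rw [cis, cis, cis, ← Complex.exp_add]
  congr 1
  push_cast
  ring

theorem cis_one : cis 1 = -1 := by rw [cis, one_mul, Complex.exp_pi_mul_I]

theorem cis_sub_one (θ : ℝ) : cis (θ - 1) = -cis θ := by
  have h := cis_add (θ - 1) 1
  rw [cis_one, sub_add_cancel] at h
  rw [h]
  ring

theorem re_cis (θ : ℝ) : (cis θ).re = Real.cos (θ * Real.pi) := Complex.exp_ofReal_mul_I_re _

theorem re_cis_pos {θ : ℝ} (h : |θ| < 1 / 2) : 0 < (cis θ).re := by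
  have hπ := Real.pi_pos
  rw [abs_lt] at h
  rw [re_cis]
  exact Real.cos_pos_of_mem_Ioo ⟨by nlinarith [h.1], by nlinarith [h.2]⟩

theorem half_le_re_cis {θ : ℝ} (h : |θ| ≤ 1 / 3) : 1 / 2 ≤ (cis θ).re := by
  have hπ := Real.pi_pos
  rw [re_cis, ← Real.cos_pi_div_three, ← Real.cos_abs (θ * Real.pi)]
  refine Real.cos_le_cos_of_nonneg_of_le_pi (abs_nonneg _) (by linarith) ?_
  rw [abs_mul, abs_of_pos hπ]
  nlinarith

theorem inHalfPlane_cis {a b θ φ : ℝ} (ha : 0 < a) (hb : 0 < b) (h : |θ - φ| < 1) :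
    InHalfPlane (a * cis θ) (b * cis φ) := by
  refine ⟨cis (-((θ + φ) / 2)), ?_, ?_⟩
  · rw [mul_assoc, ← cis_add, Complex.re_ofReal_mul]
    refine mul_pos ha (re_cis_pos ?_)
    rw [show θ + -((θ + φ) / 2) = (θ - φ) / 2 by ring, abs_div, abs_two]
    linarith
  · rw [mul_assoc, ← cis_add, Complex.re_ofReal_mul]
    refine mul_pos hb (re_cis_pos ?_)
    rw [show φ + -((θ + φ) / 2) = -((θ - φ) / 2) by ring, abs_neg, abs_div, abs_two]
    linarith

/-- In the direction `δ / 2`, at most `π / 3` from the real axis, the number 3 has component at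
least `3/2`, which `u` cannot cancel. -/
theorem inHalfPlane_three_add {u : ℂ} (hu : ‖u‖ ≤ 1) {b δ : ℝ} (hb : 0 < b) (hδ : |δ| ≤ 2 / 3) :
    InHalfPlane (3 + u) (b * cis δ) := by
  have hδ' : |δ / 2| ≤ 1 / 3 := by rw [abs_div, abs_two]; linarith
  refine ⟨cis (-(δ / 2)), ?_, ?_⟩
  · have h1 := half_le_re_cis (θ := -(δ / 2)) (by rwa [abs_neg])
    have h2 := (abs_le.1 (Complex.abs_re_le_norm (u * cis (-(δ / 2))))).1
    rw [norm_mul, norm_cis, mul_one] at h2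
    rw [add_mul, Complex.add_re, show ((3 : ℂ) = ((3 : ℝ) : ℂ)) by norm_num, Complex.re_ofReal_mul]
    linarith
  · rw [mul_assoc, ← cis_add, Complex.re_ofReal_mul, show δ + -(δ / 2) = δ / 2 by ring]
    exact mul_pos hb (by linarith [half_le_re_cis hδ'])

/-! ### Twists -/

theorem twistMap_of_norm_le {c : ℂ} {r R : ℝ} (hR : r < R) (θ : ℝ) {z : ℂ} (hz : ‖z - c‖ ≤ r) :
    twistMap c r R θ z = c + (z - c) * cis θ := by
  have h1 : 1 ≤ (R - ‖z - c‖) / (R - r) := by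
    rw [le_div_iff₀ (by linarith)]
    linarith
  have h : twistProfile r R ‖z - c‖ = 1 := by
    rw [twistProfile, min_eq_left h1]
    norm_num
  rw [twistMap, h, mul_one, cis]

theorem twistMap_zero (c : ℂ) (r R : ℝ) (z : ℂ) : twistMap c r R 0 z = z := by
  simp [twistMap]

/-- Twisting by a variable angle. -/
noncomputable def twistHomeo (c : ℂ) (r R : ℝ) (hR : r < R) (hc : ‖c‖ + R ≤ 1) (θ : ℝ) :
    Disk ≃ₜ Disk where
  toFun z := ⟨twistMap c r R θ z, twistMap_mem hR hc θ z⟩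
  invFun z := ⟨twistMap c r R (-θ) z, twistMap_mem hR hc (-θ) z⟩
  left_inv z := Subtype.ext (twistMap_neg_twistMap c r R θ z)
  right_inv z := Subtype.ext (by
    have := twistMap_neg_twistMap c r R (-θ) z
    rwa [neg_neg] at this)
  continuous_toFun :=
    ((continuous_twistMap c r R θ).comp continuous_subtype_val).subtype_mk _
  continuous_invFun :=
    ((continuous_twistMap c r R (-θ)).comp continuous_subtype_val).subtype_mk _

section twistHomeo

variable {c : ℂ} {r R : ℝ} (hR : r < R) (hc : ‖c‖ + R ≤ 1)

theorem twistHomeo_zero : twistHomeo c r R hR hc 0 = 1 := by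
  ext z
  exact twistMap_zero c r R z

theorem twistHomeo_of_norm_eq_one (θ : ℝ) {z : Disk} (hz : ‖(z : ℂ)‖ = 1) :
    twistHomeo c r R hR hc θ z = z := by
  refine Subtype.ext (twistMap_of_le hR θ ?_)
  have := norm_sub_norm_le (z : ℂ) c
  linarith

theorem isIsotopy_twistHomeo {u : unitInterval → ℝ} (hu : Continuous u) :
    IsIsotopy fun t => twistHomeo c r R hR hc (u t) := by
  refine Continuous.subtype_mk
    (f := fun p : unitInterval × Disk => twistMap c r R (u p.1) p.2) ?_ _
  unfold twistMap twistProfile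
  fun_prop

end twistHomeo

/-! ### Three half twists on three collinear points -/

/-- The time `t` truncated to the unit interval. -/
noncomputable def clamp (t : ℝ) : ℝ := max 0 (min 1 t)

theorem clamp_of_nonpos {t : ℝ} (h : t ≤ 0) : clamp t = 0 := by
  rw [clamp, max_eq_left]
  exact (min_le_right _ _).trans h

theorem clamp_of_one_le {t : ℝ} (h : 1 ≤ t) : clamp t = 1 := by
  rw [clamp, min_eq_left h]
  norm_num

theorem clamp_of_mem {t : ℝ} (h : 0 ≤ t) (h' : t ≤ 1) : clamp t = t := by
  rw [clamp, min_eq_right h', max_eq_right h]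

/-- The motion that performs one after the other half twists about `q - w`, `q + w`, `q - w`. -/
noncomputable def threeTwists (q w : ℂ) (r R τ : ℝ) (z : ℂ) : ℂ :=
  twistMap (q - w) r R (clamp (τ - 2))
    (twistMap (q + w) r R (clamp (τ - 1)) (twistMap (q - w) r R (clamp τ) z))

section threeTwists

variable {q w : ℂ} {ρ R : ℝ}

theorem twistMap_two_left (hρ : 0 < ρ) (hw : ‖w‖ = ρ) (θ : ℝ) :
    twistMap q (2 * ρ) (3 * ρ) θ (q - 2 * w) = q + w * (-(2 * cis θ)) := by
  rw [twistMap_of_norm_le (by linarith)]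
  · ring
  · rw [show q - 2 * w - q = -2 * w by ring, norm_mul, hw]
    norm_num

theorem twistMap_two_mid (w : ℂ) (ρ θ : ℝ) : twistMap q (2 * ρ) (3 * ρ) θ q = q + w * 0 := by
  simp [twistMap]

theorem twistMap_two_right (hρ : 0 < ρ) (hw : ‖w‖ = ρ) (θ : ℝ) :
    twistMap q (2 * ρ) (3 * ρ) θ (q + 2 * w) = q + w * (2 * cis θ) := by
  rw [twistMap_of_norm_le (by linarith)]
  · ring
  · rw [show q + 2 * w - q = 2 * w by ring, norm_mul, hw]
    norm_num

variable (hρ : 0 < ρ) (hR : R = 3 / 2 * ρ) (hw : ‖w‖ = ρ)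
include hρ hR hw

/-- The points `q - 2 * w` and `q` lie on the circle of radius `ρ` about `q - w` and rotate rigidly,
while `q + 2 * w` is at distance `3 * ρ`, beyond the support radius `R`. The next lemmas treat the
other cases in the same way. -/
theorem twistMap_sub_left (θ : ℝ) :
    twistMap (q - w) ρ R θ (q - 2 * w) = q + w * (-1 - cis θ) := by
  rw [twistMap_of_norm_le (by linarith)]
  · ring
  · rw [show q - 2 * w - (q - w) = -w by ring, norm_neg, hw]

theorem twistMap_sub_mid (θ : ℝ) : twistMap (q - w) ρ R θ q = q + w * (-1 + cis θ) := by
  rw [twistMap_of_norm_le (by linarith)]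
  · ring
  · rw [show q - (q - w) = w by ring, hw]

theorem twistMap_sub_right (θ : ℝ) : twistMap (q - w) ρ R θ (q + 2 * w) = q + 2 * w := by
  rw [twistMap_of_le (by linarith)]
  rw [show q + 2 * w - (q - w) = 3 * w by ring, norm_mul, hw]
  norm_num
  linarith

theorem twistMap_add_left (θ : ℝ) : twistMap (q + w) ρ R θ (q - 2 * w) = q - 2 * w := by
  rw [twistMap_of_le (by linarith)]
  rw [show q - 2 * w - (q + w) = -3 * w by ring, norm_mul, hw]
  norm_num
  linarith

theorem twistMap_add_mid (θ : ℝ) : twistMap (q + w) ρ R θ q = q + w * (1 - cis θ) := by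
  rw [twistMap_of_norm_le (by linarith)]
  · ring
  · rw [show q - (q + w) = -w by ring, norm_neg, hw]

theorem twistMap_add_right (θ : ℝ) :
    twistMap (q + w) ρ R θ (q + 2 * w) = q + w * (1 + cis θ) := by
  rw [twistMap_of_norm_le (by linarith)]
  · ring
  · rw [show q + 2 * w - (q + w) = w by ring, hw]

theorem threeTwists_of_far (τ : ℝ) {z : ℂ} (hz : 4 * ρ ≤ ‖z - q‖) :
    threeTwists q w ρ R τ z = z := by
  have h1 : ∀ θ, twistMap (q - w) ρ R θ z = z := fun θ => by
    refine twistMap_of_le (by linarith) θ ?_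
    have := norm_sub_le (z - (q - w)) w
    rw [show z - (q - w) - w = z - q by ring] at this
    linarith
  have h2 : ∀ θ, twistMap (q + w) ρ R θ z = z := fun θ => by
    refine twistMap_of_le (by linarith) θ ?_
    have := norm_add_le (z - (q + w)) w
    rw [show z - (q + w) + w = z - q by ring] at this
    linarith
  rw [threeTwists, h1, h2, h1]

/-- The positions of the three points during the motion, compared with a rigid rotation. -/
theorem exists_threeTwists_eq {τ : ℝ} (h0 : 0 ≤ τ) (h3 : τ ≤ 3) :
    ∃ α β γ : ℂ, threeTwists q w ρ R τ (q - 2 * w) = q + w * α ∧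
      threeTwists q w ρ R τ q = q + w * β ∧
      threeTwists q w ρ R τ (q + 2 * w) = q + w * γ ∧
      ‖α‖ ≤ 2 ∧ ‖β‖ ≤ 2 ∧ ‖γ‖ ≤ 2 ∧
      InHalfPlane (α - β) (-(2 * cis (τ / 3))) ∧ InHalfPlane (α - γ) (-(4 * cis (τ / 3))) ∧
      InHalfPlane (β - γ) (-(2 * cis (τ / 3))) := by
  have n1 : ∀ θ, ‖-1 - cis θ‖ ≤ 2 := fun θ =>
    (norm_sub_le _ _).trans (by rw [norm_neg, norm_one, norm_cis]; norm_num)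
  have n2 : ∀ θ, ‖-1 + cis θ‖ ≤ 2 := fun θ =>
    (norm_add_le _ _).trans (by rw [norm_neg, norm_one, norm_cis]; norm_num)
  have n3 : ∀ θ, ‖1 - cis θ‖ ≤ 2 := fun θ =>
    (norm_sub_le _ _).trans (by rw [norm_one, norm_cis]; norm_num)
  have n4 : ∀ θ, ‖1 + cis θ‖ ≤ 2 := fun θ =>
    (norm_add_le _ _).trans (by rw [norm_one, norm_cis]; norm_num)
  have hpos : ∀ θ δ b : ℝ, 0 < b → |δ| ≤ 2 / 3 → InHalfPlane (3 + cis θ) (b * cis δ) :=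
    fun θ δ b hb hδ => inHalfPlane_three_add (norm_cis θ).le hb hδ
  have hneg : ∀ θ δ b : ℝ, 0 < b → |δ| ≤ 2 / 3 → InHalfPlane (3 - cis θ) (b * cis δ) :=
    fun θ δ b hb hδ => by
      rw [sub_eq_add_neg]
      exact inHalfPlane_three_add (by rw [norm_neg, norm_cis]) hb hδ
  have hrot : ∀ θ φ b : ℝ, 0 < b → |θ - φ| < 1 →
      InHalfPlane (2 * cis θ) (b * cis φ) := fun θ φ b hb h => by
    exact_mod_cast inHalfPlane_cis two_pos hb h
  have eA : q + w * (-1 - cis 1) = q := by rw [cis_one]; ring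
  have eA' : q + w * (-1 + cis 1) = q - 2 * w := by rw [cis_one]; ring
  have eB : q + w * (1 - cis 1) = q + 2 * w := by rw [cis_one]; ring
  have eB' : q + w * (1 + cis 1) = q := by rw [cis_one]; ring
  have hsub : ∀ b φ, -(b * cis φ) = b * cis (φ - 1) := fun b φ => by rw [cis_sub_one]; ring
  simp only [threeTwists]
  -- In each unit of time one twist is active. The difference of its two points is `±2 cis θ`, and
  -- the two other differences have the form `±(3 ± cis θ)`. The rigid rotation has angle `τ / 3`:
  -- it differs from `θ` by at most `2/3`, and the sign-adjusted angle compared with `3 ± cis θ` is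
  -- also at most `2/3` in absolute value.
  rcases le_total τ 1 with h1 | h1
  · rw [clamp_of_mem h0 h1, clamp_of_nonpos (show τ - 1 ≤ 0 by linarith),
      clamp_of_nonpos (show τ - 2 ≤ 0 by linarith)]
    simp only [twistMap_zero]
    refine ⟨-1 - cis τ, -1 + cis τ, 2, twistMap_sub_left hρ hR hw τ, twistMap_sub_mid hρ hR hw τ,
      (twistMap_sub_right hρ hR hw τ).trans (by ring), n1 _, n2 _, by norm_num, ?_, ?_, ?_⟩
    · rw [show -1 - cis τ - (-1 + cis τ) = -(2 * cis τ) by ring]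
      exact_mod_cast (hrot τ (τ / 3) 2 two_pos (by rw [abs_lt]; constructor <;> linarith)).neg
    · rw [show -1 - cis τ - 2 = -(3 + cis τ) by ring]
      exact_mod_cast (hpos τ (τ / 3) 4 four_pos (by rw [abs_le]; constructor <;> linarith)).neg
    · rw [show -1 + cis τ - 2 = -(3 - cis τ) by ring]
      exact_mod_cast (hneg τ (τ / 3) 2 two_pos (by rw [abs_le]; constructor <;> linarith)).neg
  rcases le_total τ 2 with h2 | h2
  · rw [clamp_of_one_le h1, clamp_of_mem (show 0 ≤ τ - 1 by linarith) (by linarith),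
      clamp_of_nonpos (show τ - 2 ≤ 0 by linarith)]
    simp only [twistMap_zero, twistMap_sub_left hρ hR hw, twistMap_sub_mid hρ hR hw,
      twistMap_sub_right hρ hR hw, eA, eA']
    refine ⟨1 - cis (τ - 1), -2, 1 + cis (τ - 1), twistMap_add_mid hρ hR hw _,
      (twistMap_add_left hρ hR hw _).trans (by ring), twistMap_add_right hρ hR hw _, n3 _,
      by norm_num, n4 _, ?_, ?_, ?_⟩
    · rw [show 1 - cis (τ - 1) - -2 = 3 - cis (τ - 1) by ring, hsub]
      exact_mod_cast hneg _ (τ / 3 - 1) 2 two_pos (by rw [abs_le]; constructor <;> linarith)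
    · rw [show 1 - cis (τ - 1) - (1 + cis (τ - 1)) = -(2 * cis (τ - 1)) by ring]
      exact_mod_cast (hrot _ (τ / 3) 4 four_pos (by rw [abs_lt]; constructor <;> linarith)).neg
    · rw [show -2 - (1 + cis (τ - 1)) = -(3 + cis (τ - 1)) by ring]
      exact_mod_cast (hpos _ (τ / 3) 2 two_pos (by rw [abs_le]; constructor <;> linarith)).neg
  · rw [clamp_of_one_le h1, clamp_of_one_le (show 1 ≤ τ - 1 by linarith),
      clamp_of_mem (show 0 ≤ τ - 2 by linarith) (by linarith)]
    simp only [twistMap_sub_left hρ hR hw, twistMap_sub_mid hρ hR hw,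
      twistMap_sub_right hρ hR hw, twistMap_add_left hρ hR hw, twistMap_add_mid hρ hR hw,
      twistMap_add_right hρ hR hw, eA, eA', eB, eB']
    refine ⟨2, -1 - cis (τ - 2), -1 + cis (τ - 2), by ring, rfl, rfl, by norm_num, n1 _, n2 _,
      ?_, ?_, ?_⟩
    · rw [show 2 - (-1 - cis (τ - 2)) = 3 + cis (τ - 2) by ring, hsub]
      exact_mod_cast hpos _ (τ / 3 - 1) 2 two_pos (by rw [abs_le]; constructor <;> linarith)
    · rw [show 2 - (-1 + cis (τ - 2)) = 3 - cis (τ - 2) by ring, hsub]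
      exact_mod_cast hneg _ (τ / 3 - 1) 4 four_pos (by rw [abs_le]; constructor <;> linarith)
    · rw [show -1 - cis (τ - 2) - (-1 + cis (τ - 2)) = -(2 * cis (τ - 2)) by ring]
      exact_mod_cast (hrot _ (τ / 3) 2 two_pos (by rw [abs_lt]; constructor <;> linarith)).neg

theorem inHalfPlane_threeTwists {τ : ℝ} (h0 : 0 ≤ τ) (h3 : τ ≤ 3) {z z' : ℂ} (hzz : z ≠ z')
    (hz : z = q - 2 * w ∨ z = q ∨ z = q + 2 * w ∨ 4 * ρ ≤ ‖z - q‖)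
    (hz' : z' = q - 2 * w ∨ z' = q ∨ z' = q + 2 * w ∨ 4 * ρ ≤ ‖z' - q‖) :
    InHalfPlane (threeTwists q w ρ R τ z - threeTwists q w ρ R τ z')
      (twistMap q (2 * ρ) (3 * ρ) (τ / 3) z - twistMap q (2 * ρ) (3 * ρ) (τ / 3) z') := by
  obtain ⟨α, β, γ, eα, eβ, eγ, hα, hβ, hγ, hαβ, hαγ, hβγ⟩ :=
    exists_threeTwists_eq (q := q) hρ hR hw h0 h3
  have hw0 : w ≠ 0 := by rw [← norm_pos_iff, hw]; exact hρ
  have far : ∀ z, 4 * ρ ≤ ‖z - q‖ → twistMap q (2 * ρ) (3 * ρ) (τ / 3) z = z := fun z hz =>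
    twistMap_of_le (by linarith) _ (by linarith)
  have near : ∀ a b a' b' : ℂ, InHalfPlane (a - a') (b - b') →
      InHalfPlane (q + w * a - (q + w * a')) (q + w * b - (q + w * b')) := fun a b a' b' h => by
    have := h.mul_left hw0
    rwa [mul_sub, mul_sub, ← add_sub_add_left_eq_sub (w * a) _ q,
      ← add_sub_add_left_eq_sub (w * b) _ q] at this
  have swap : ∀ u v u' v' : ℂ, InHalfPlane (u - u') (v - v') → InHalfPlane (u' - u) (v' - v) :=
    fun u v u' v' h => by simpa using h.neg
  have hαβ' := near α (-(2 * cis (τ / 3))) β 0 (by rwa [sub_zero])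
  have hαγ' := near α (-(2 * cis (τ / 3))) γ (2 * cis (τ / 3))
    (by convert hαγ using 1; ring)
  have hβγ' := near β 0 γ (2 * cis (τ / 3)) (by rwa [zero_sub])
  have nc : ‖2 * cis (τ / 3)‖ ≤ 2 := by rw [norm_mul, norm_cis]; norm_num
  have hfar : ∀ a b p : ℂ, ‖a‖ ≤ 2 → ‖b‖ ≤ 2 → 4 * ρ ≤ ‖p - q‖ →
      InHalfPlane (q + w * a - p) (q + w * b - p) := fun a b p ha hb hp => by
    refine inHalfPlane_of_far hρ ?_ ?_ hp
    · rw [add_sub_cancel_left, norm_mul, hw]; nlinarith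
    · rw [add_sub_cancel_left, norm_mul, hw]; nlinarith
  -- Both motions fix far points, so mixed near-far pairs follow from distances alone, and a far-far
  -- difference is constant.
  rcases hz with rfl | rfl | rfl | hz <;> rcases hz' with rfl | rfl | rfl | hz' <;>
    (try exact absurd rfl hzz) <;>
    (try simp only [eα, eβ, eγ, twistMap_two_left hρ hw, twistMap_two_mid w,
      twistMap_two_right hρ hw]) <;>
    (try simp only [far _ hz, threeTwists_of_far hρ hR hw τ hz]) <;>
    (try simp only [far _ hz', threeTwists_of_far hρ hR hw τ hz'])
  · exact hαβ'
  · exact hαγ'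
  · exact hfar _ _ _ hα (by rwa [norm_neg]) hz'
  · exact swap _ _ _ _ hαβ'
  · exact hβγ'
  · exact hfar _ _ _ hβ (by norm_num) hz'
  · exact swap _ _ _ _ hαγ'
  · exact swap _ _ _ _ hβγ'
  · exact hfar _ _ _ hγ nc hz'
  · exact swap _ _ _ _ (hfar _ _ _ hα (by rwa [norm_neg]) hz)
  · exact swap _ _ _ _ (hfar _ _ _ hβ (by norm_num) hz)
  · exact swap _ _ _ _ (hfar _ _ _ hγ nc hz)
  · exact inHalfPlane_self (sub_ne_zero.2 hzz)

theorem threeTwists_three {z : ℂ}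
    (hz : z = q - 2 * w ∨ z = q ∨ z = q + 2 * w ∨ 4 * ρ ≤ ‖z - q‖) :
    threeTwists q w ρ R 3 z = twistMap q (2 * ρ) (3 * ρ) 1 z := by
  have eA : q + w * (-1 - cis 1) = q := by rw [cis_one]; ring
  have eA' : q + w * (-1 + cis 1) = q - 2 * w := by rw [cis_one]; ring
  have eB : q + w * (1 - cis 1) = q + 2 * w := by rw [cis_one]; ring
  have eB' : q + w * (1 + cis 1) = q := by rw [cis_one]; ring
  rcases hz with rfl | rfl | rfl | hz
  case inr.inr.inr =>
    rw [threeTwists_of_far hρ hR hw 3 hz, twistMap_of_le (by linarith) _ (by linarith)]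
  all_goals
    rw [threeTwists, clamp_of_one_le (by norm_num), clamp_of_one_le (by norm_num),
      clamp_of_one_le (by norm_num)]
    simp only [twistMap_sub_left hρ hR hw, twistMap_sub_mid hρ hR hw,
      twistMap_sub_right hρ hR hw, twistMap_add_left hρ hR hw, twistMap_add_mid hρ hR hw,
      twistMap_add_right hρ hR hw, eA, eA', eB, eB', twistMap_two_left hρ hw,
      twistMap_two_mid w, twistMap_two_right hρ hw]
    try rw [cis_one]
    ring

end threeTwists

/-- The class of the half rotation does not change when `w` becomes `-w`, whereas the two centres
are exchanged; this symmetry yields the braid relation. The centres `c`, `c'` are tied to `q ∓ w` by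
equations so that products of the standard half twists match `hf` definitionally. -/
theorem mk_threeTwists {n : ℕ} (hn : 0 < n) {q w c c' : ℂ} {R : ℝ} (hw : ‖w‖ = 1 / n)
    (hrR : 1 / (n : ℝ) < R) (hR : R = 3 / 2 * (1 / n)) (hcq : c = q - w) (hcq' : c' = q + w)
    (hc : ‖c‖ + R ≤ 1) (hc' : ‖c'‖ + R ≤ 1) (h23 : 2 * (1 / (n : ℝ)) < 3 * (1 / n))
    (hq : ‖q‖ + 3 * (1 / n) ≤ 1)
    (hP : ∀ k, (puncture n k : ℂ) = q - 2 * w ∨ (puncture n k : ℂ) = q ∨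
      (puncture n k : ℂ) = q + 2 * w ∨ 4 * (1 / (n : ℝ)) ≤ ‖(puncture n k : ℂ) - q‖)
    (f : HomeoRel n)
    (hf : (f : Disk ≃ₜ Disk) = twistHomeo c (1 / n) R hrR hc 1 * twistHomeo c' (1 / n) R hrR hc' 1 *
      twistHomeo c (1 / n) R hrR hc 1) :
    ∃ hg : twistHomeo q (2 * (1 / n)) (3 * (1 / n)) h23 hq 1 ∈ HomeoRel n,
      (QuotientGroup.mk f : MCG n) = QuotientGroup.mk ⟨_, hg⟩ := by
  subst hcq hcq'
  have hρ : 0 < 1 / (n : ℝ) := by positivity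
  let F : unitInterval → Disk ≃ₜ Disk := fun t =>
    twistHomeo (q - w) (1 / n) R hrR hc (clamp (3 * t - 2)) *
      twistHomeo (q + w) (1 / n) R hrR hc' (clamp (3 * t - 1)) *
      twistHomeo (q - w) (1 / n) R hrR hc (clamp (3 * t))
  let G : unitInterval → Disk ≃ₜ Disk := fun t =>
    twistHomeo q (2 * (1 / n)) (3 * (1 / n)) h23 hq (3 * t / 3)
  have hFv : ∀ t z, (F t z : ℂ) = threeTwists q w (1 / n) R (3 * t) z := fun _ _ => rfl
  have hGv : ∀ t z, (G t z : ℂ) = twistMap q (2 * (1 / n)) (3 * (1 / n)) (3 * t / 3) z :=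
    fun _ _ => rfl
  have hF : IsIsotopy F :=
    ((isIsotopy_twistHomeo hrR hc (by unfold clamp; fun_prop)).mul
      (isIsotopy_twistHomeo hrR hc' (by unfold clamp; fun_prop))).mul
      (isIsotopy_twistHomeo hrR hc (by unfold clamp; fun_prop))
  have hG : IsIsotopy G := isIsotopy_twistHomeo h23 hq (by fun_prop)
  have F_zero : F 0 = 1 := by
    simp only [F, Set.Icc.coe_zero]
    rw [clamp_of_nonpos (by norm_num), clamp_of_nonpos (by norm_num), clamp_of_nonpos (by norm_num),
      twistHomeo_zero, twistHomeo_zero, one_mul, one_mul]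
  have F_one : F 1 = f := by
    simp only [F, Set.Icc.coe_one]
    rw [clamp_of_one_le (by norm_num), clamp_of_one_le (by norm_num),
      clamp_of_one_le (by norm_num), hf]
  have G_zero : G 0 = 1 := by
    simp only [G, Set.Icc.coe_zero, mul_zero, zero_div]
    exact twistHomeo_zero _ _
  have G_one : G 1 = twistHomeo q (2 * (1 / n)) (3 * (1 / n)) h23 hq 1 := by
    simp only [G, Set.Icc.coe_one, mul_one]
    norm_num
  have hfg : ∀ j, F 1 (puncture n j) = G 1 (puncture n j) := fun j => Subtype.ext <| by
    rw [hFv, hGv, Set.Icc.coe_one, mul_one, threeTwists_three hρ hR hw (hP j)]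
    norm_num
  have hGb : ∀ t, ∀ z : Disk, ‖(z : ℂ)‖ = 1 → G t z = z := fun t z hz =>
    twistHomeo_of_norm_eq_one _ _ _ hz
  have hg : twistHomeo q (2 * (1 / n)) (3 * (1 / n)) h23 hq 1 ∈ HomeoRel n := by
    rw [← G_one]
    refine ⟨hGb 1, ?_⟩
    have h := f.2.2
    rw [← F_one] at h
    conv_rhs => rw [← h]
    rw [punctures, ← Set.range_comp, ← Set.range_comp]
    exact congrArg Set.range (funext fun j => (hfg j).symm)
  refine ⟨hg, mk_eq_mk_of_segment hF hG F_zero G_zero (fun t z hz => ?_) hGb F_one G_one hfg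
    fun t i j hij => ?_⟩
  · simp only [F, Homeomorph.mul_apply]
    rw [twistHomeo_of_norm_eq_one _ _ _ hz, twistHomeo_of_norm_eq_one _ _ _ hz,
      twistHomeo_of_norm_eq_one _ _ _ hz]
  · refine (inHalfPlane_threeTwists hρ hR hw ?_ ?_ ?_ (hP i) (hP j)).zero_notMem_segment
    · linarith [t.2.1]
    · linarith [t.2.2]
    · exact fun h => hij (puncture_injective n (Subtype.ext h))

/-! ### The braid relations in the mapping class group -/

/-- Here `q` is the middle puncture of the three involved and `2 * w` is the spacing of the
punctures. Both words equal the half rotation about `q`: apply `mk_threeTwists` with `w` and with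
`-w`. -/
theorem sigma_braid {n : ℕ} (i j : Fin (n - 1)) (hij : (j : ℕ) = i + 1) :
    sigma i * sigma j * sigma i = sigma j * sigma i * sigma j := by
  have hn := pos_of_fin i
  have hj := j.2
  have hn' : 0 < n := by exact_mod_cast hn
  have hin : ((i : ℕ) : ℝ) + 3 ≤ n := by exact_mod_cast (show (i : ℕ) + 3 ≤ n by omega)
  have hi0 : (0 : ℝ) ≤ (i : ℕ) := Nat.cast_nonneg _
  set q : ℂ := (height n (i + 1) : ℂ) * Complex.I with hq_def
  set w : ℂ := ((1 / n : ℝ) : ℂ) * Complex.I with hw_def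
  have hw : ‖w‖ = 1 / n := by
    rw [hw_def, norm_mul, Complex.norm_I, mul_one, Complex.norm_real, Real.norm_eq_abs,
      abs_of_pos (by positivity)]
  have hc : midpt n i = q - w := by
    rw [midpt, hq_def, hw_def, height, ← sub_mul, ← Complex.ofReal_sub]
    congr 2
    push_cast
    ring
  have hc' : midpt n j = q + w := by
    rw [midpt, hq_def, hw_def, height, ← add_mul, ← Complex.ofReal_add, hij]
    congr 2
    push_cast
    ring
  have hq : ‖q‖ + 3 * (1 / n) ≤ 1 := by
    have h : ‖q‖ ≤ 1 - 3 / n := by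
      rw [hq_def, height, norm_mul, Complex.norm_I, mul_one, Complex.norm_real, Real.norm_eq_abs,
        abs_le]
      push_cast
      constructor
      · rw [← sub_nonneg]; field_simp; linarith
      · rw [← sub_nonneg]; field_simp; linarith
    have : 3 * (1 / (n : ℝ)) = 3 / n := by ring
    linarith
  have h23 : 2 * (1 / (n : ℝ)) < 3 * (1 / n) := by
    have : 0 < 1 / (n : ℝ) := by positivity
    linarith
  have hR : 3 / 2 / (n : ℝ) = 3 / 2 * (1 / n) := by ring
  have hsub : ∀ k : Fin n, (puncture n k : ℂ) - q
      = ((2 * ((k : ℝ) - ((i : ℕ) + 1)) / n : ℝ) : ℂ) * Complex.I := fun k => by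
    simp only [puncture, hq_def, height]
    rw [← sub_mul, ← Complex.ofReal_sub]
    congr 2
    push_cast
    ring
  have hP : ∀ k, (puncture n k : ℂ) = q - 2 * w ∨ (puncture n k : ℂ) = q ∨
      (puncture n k : ℂ) = q + 2 * w ∨ 4 * (1 / (n : ℝ)) ≤ ‖(puncture n k : ℂ) - q‖ := by
    intro k
    have hk := hsub k
    by_cases h1 : (k : ℕ) = i
    · left
      rw [h1] at hk
      rw [sub_eq_iff_eq_add.1 hk, hw_def]
      push_cast
      ring
    by_cases h2 : (k : ℕ) = i + 1
    · right; left
      rw [h2] at hk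
      rw [sub_eq_iff_eq_add.1 hk]
      push_cast
      ring
    by_cases h3 : (k : ℕ) = i + 2
    · right; right; left
      rw [h3] at hk
      rw [sub_eq_iff_eq_add.1 hk, hw_def]
      push_cast
      ring
    right; right; right
    rw [hk, norm_mul, Complex.norm_I, mul_one, Complex.norm_real, Real.norm_eq_abs, abs_div,
      abs_of_pos hn, mul_one_div]
    refine div_le_div_of_nonneg_right ?_ hn.le
    have h4 : (k : ℕ) + 1 ≤ i ∨ (i : ℕ) + 3 ≤ k := by omega
    rcases h4 with h4 | h4
    · have : (k : ℝ) + 1 ≤ (i : ℕ) := by exact_mod_cast h4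
      exact le_trans (by linarith) (neg_le_abs _)
    · have : ((i : ℕ) : ℝ) + 3 ≤ k := by exact_mod_cast h4
      exact le_trans (by linarith) (le_abs_self _)
  have hP' : ∀ k, (puncture n k : ℂ) = q - 2 * -w ∨ (puncture n k : ℂ) = q ∨
      (puncture n k : ℂ) = q + 2 * -w ∨ 4 * (1 / (n : ℝ)) ≤ ‖(puncture n k : ℂ) - q‖ := by
    intro k
    rw [mul_neg, sub_neg_eq_add, ← sub_eq_add_neg]
    have := hP k
    tauto
  let si : HomeoRel n := ⟨sigmaHomeo n i, sigmaHomeo_mem n i⟩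
  let sj : HomeoRel n := ⟨sigmaHomeo n j, sigmaHomeo_mem n j⟩
  obtain ⟨hg, e⟩ := mk_threeTwists hn' hw (radius_lt i) hR hc hc' (norm_midpt_add_radius_lt i).le
    (norm_midpt_add_radius_lt j).le h23 hq hP (si * sj * si) rfl
  obtain ⟨_, e'⟩ := mk_threeTwists hn' ((norm_neg w).trans hw) (radius_lt i) hR
    (hc'.trans (sub_neg_eq_add q w).symm) (hc.trans (sub_eq_add_neg q w))
    (norm_midpt_add_radius_lt j).le (norm_midpt_add_radius_lt i).le h23 hq hP' (sj * si * sj) rfl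
  exact e.trans e'.symm

/-- The supports meet at most on their boundaries, and each twist preserves the circles about its
own centre. -/
theorem twistMap_comm {c c' : ℂ} {r R r' R' : ℝ} (hR : r < R) (hR' : r' < R')
    (h : R + R' ≤ ‖c - c'‖) (θ θ' : ℝ) (z : ℂ) :
    twistMap c r R θ (twistMap c' r' R' θ' z) = twistMap c' r' R' θ' (twistMap c r R θ z) := by
  have h1 : ∀ z, ‖z - c‖ < R → R' ≤ ‖z - c'‖ := fun z hz => by
    have := norm_sub_le_norm_sub_add_norm_sub c z c'
    rw [norm_sub_rev c z] at this
    linarith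
  rcases lt_or_ge ‖z - c‖ R with hz | hz
  · rw [twistMap_of_le hR' θ' (h1 z hz),
      twistMap_of_le hR' θ' (h1 _ ((norm_twistMap_sub c r R θ z).trans_lt hz))]
  rw [twistMap_of_le hR θ hz, twistMap_of_le hR]
  by_contra hlt
  rw [not_le] at hlt
  have h2 := h1 _ hlt
  rw [norm_twistMap_sub] at h2
  rw [twistMap_of_le hR' θ' h2] at hlt
  linarith

theorem sigma_comm {n : ℕ} (i j : Fin (n - 1)) (hij : (i : ℕ) + 2 ≤ j) :
    sigma i * sigma j = sigma j * sigma i := by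
  have hn := pos_of_fin i
  have hij' : ((i : ℕ) : ℝ) + 2 ≤ (j : ℕ) := by exact_mod_cast hij
  have hd : 3 / 2 / (n : ℝ) + 3 / 2 / (n : ℝ) ≤ ‖midpt n i - midpt n j‖ := by
    rw [midpt, midpt, ← sub_mul, ← Complex.ofReal_sub, norm_mul, Complex.norm_I, mul_one,
      Complex.norm_real, Real.norm_eq_abs, ← sub_div, abs_div, abs_of_pos hn, ← add_div]
    refine div_le_div_of_nonneg_right (le_trans ?_ (neg_le_abs _)) hn.le
    linarith
  refine congrArg (QuotientGroup.mk (s := isotopicToId n)) (Subtype.ext (Homeomorph.ext fun z => ?_) :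
    (⟨sigmaHomeo n i, sigmaHomeo_mem n i⟩ * ⟨sigmaHomeo n j, sigmaHomeo_mem n j⟩ : HomeoRel n) =
      ⟨sigmaHomeo n j, sigmaHomeo_mem n j⟩ * ⟨sigmaHomeo n i, sigmaHomeo_mem n i⟩)
  exact Subtype.ext (twistMap_comm (radius_lt i) (radius_lt j) hd 1 1 z)

/-! ### Conjugates of the generators -/

theorem apply_mem_punctures_iff {n : ℕ} (f : HomeoRel n) (z : Disk) :
    (f : Disk ≃ₜ Disk) z ∈ punctures n ↔ z ∈ punctures n := by
  conv_lhs => rw [← f.2.2]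
  exact (f : Disk ≃ₜ Disk).injective.mem_set_image

/-- A representative `f` of `x` carries the standard segment and its round neighbourhood to an arc
with a neighbourhood, and `f` itself serves as the transporting homeomorphism. -/
theorem exists_isHalfTwist_conj {n : ℕ} (x : MCG n) (i : Fin (n - 1)) :
    ∃ γ : PunctureArc n, IsHalfTwist γ (x * sigma i * x⁻¹) := by
  obtain ⟨f, rfl⟩ := QuotientGroup.mk_surjective x
  have hn := pos_of_fin i
  have hi := i.2
  have hcR := norm_midpt_add_radius_lt i
  have hrR := radius_lt i
  have hr : 0 < 1 / (n : ℝ) := by positivity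
  set c := midpt n i with hc_def
  let a : unitInterval → ℂ := fun t => c + ((2 * (t : ℝ) - 1) / n : ℝ) * Complex.I
  have ha_sub : ∀ t, ‖a t - c‖ = |2 * (t : ℝ) - 1| / n := fun t => by
    rw [add_sub_cancel_left, norm_mul, Complex.norm_I, mul_one, Complex.norm_real,
      Real.norm_eq_abs, abs_div, abs_of_pos hn]
  have ha_lt : ∀ t, ‖a t‖ < 1 := fun t => by
    have h1 : |2 * (t : ℝ) - 1| / n ≤ 1 / n := by
      refine div_le_div_of_nonneg_right (abs_le.2 ?_) hn.le
      constructor <;> linarith [t.2.1, t.2.2]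
    have h2 := norm_le_norm_add_norm_sub' (a t) c
    rw [ha_sub] at h2
    linarith
  let b : unitInterval → Disk := fun t => ⟨a t, mem_closedBall_zero_iff.2 (ha_lt t).le⟩
  have hb : Continuous b := by
    refine Continuous.subtype_mk ?_ _
    fun_prop
  have hab : ∀ t (k : Fin n), (puncture n k : ℂ) = a t ↔ (k : ℝ) - (i : ℕ) = t := fun t k => by
    rw [← sub_left_inj (a := c), puncture_sub_midpt, add_sub_cancel_left,
      mul_left_inj' Complex.I_ne_zero, Complex.ofReal_inj, div_left_inj' hn.ne']
    constructor <;> intro h <;> linarith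
  have hbp : ∀ t, b t ∈ punctures n ↔ t = 0 ∨ t = 1 := by
    intro t
    constructor
    · rintro ⟨k, hk⟩
      have h := (hab t k).1 (congrArg Subtype.val hk)
      have h0 : (i : ℕ) ≤ k := by
        have : ((i : ℕ) : ℝ) ≤ k := by linarith [t.2.1]
        exact_mod_cast this
      have h1 : (k : ℕ) ≤ i + 1 := by
        have : (k : ℝ) ≤ (i : ℕ) + 1 := by linarith [t.2.2]
        exact_mod_cast this
      rcases h0.eq_or_lt with h0 | h0
      · left
        exact Subtype.ext (by rw [← h, h0]; simp)
      · right
        have : (k : ℕ) = i + 1 := by omega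
        exact Subtype.ext (by rw [← h, this]; simp)
    · rintro (rfl | rfl)
      · exact ⟨⟨i, by omega⟩, Subtype.ext ((hab 0 _).2 (by simp))⟩
      · exact ⟨⟨i + 1, by omega⟩, Subtype.ext ((hab 1 _).2 (by simp))⟩
  let γ : PunctureArc n :=
    { toFun := fun t => (f : Disk ≃ₜ Disk) (b t)
      continuous_toFun := (f : Disk ≃ₜ Disk).continuous.comp hb
      injective_toFun := by
        refine (f : Disk ≃ₜ Disk).injective.comp fun t t' h => Subtype.ext ?_
        have h1 : a t = a t' := congrArg Subtype.val h
        simp only [a, add_right_inj, mul_left_inj' Complex.I_ne_zero, Complex.ofReal_inj,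
          div_left_inj' hn.ne'] at h1
        linarith
      mem_interior := fun t => norm_lt_one_of_fix_boundary f.2.1 (ha_lt t)
      mem_punctures_iff := fun t => (apply_mem_punctures_iff f _).trans (hbp t) }
  refine ⟨γ, f, c, 1 / n, 3 / 2 / n, hrR, hcR,
    f * ⟨sigmaHomeo n i, sigmaHomeo_mem n i⟩ * f⁻¹, hr, f.2.1, ?_, ?_, rfl, rfl⟩
  · change Set.range ((f : Disk ≃ₜ Disk) ∘ b) = _
    rw [Set.range_comp]
    congr 1
    ext z
    constructor
    · rintro ⟨t, rfl⟩
      refine ⟨(2 * (t : ℝ) - 1) / n, ⟨?_, ?_⟩, rfl⟩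
      · rw [← neg_div]
        exact div_le_div_of_nonneg_right (by linarith [t.2.1]) hn.le
      · exact div_le_div_of_nonneg_right (by linarith [t.2.2]) hn.le
    · rintro ⟨t, ⟨h1, h2⟩, hz⟩
      rw [← neg_div, div_le_iff₀ hn] at h1
      rw [le_div_iff₀ hn] at h2
      refine ⟨⟨(t * n + 1) / 2, by linarith, by linarith⟩, Subtype.ext ?_⟩
      rw [hz]
      simp only [b, a]
      congr 3
      field_simp
      ring
  -- Punctures lie at odd multiples of `1 / n` from the midpoint, so radius `3 / 2 / n` captures
  -- only the two nearest.
  · intro z hz hzp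
    obtain ⟨k, rfl⟩ := (apply_mem_punctures_iff f z).1 hzp
    rw [norm_puncture_sub_midpt, div_le_div_iff_of_pos_right hn, abs_le] at hz
    have h0 : (i : ℕ) ≤ k := by
      by_contra hlt
      have : (k : ℝ) + 1 ≤ (i : ℕ) := by exact_mod_cast not_le.1 hlt
      linarith [hz.1]
    have h1 : (k : ℕ) ≤ i + 1 := by
      by_contra hlt
      have : ((i : ℕ) : ℝ) + 2 ≤ k := by exact_mod_cast not_le.1 hlt
      linarith [hz.2]
    rcases h0.eq_or_lt with h0 | h0
    · left
      exact congrArg _ (Subtype.ext ((hab 0 k).2 (by rw [h0]; simp)))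
    · right
      have : (k : ℕ) = i + 1 := by omega
      exact congrArg _ (Subtype.ext ((hab 1 k).2 (by rw [this]; simp)))

end PuncturedDisk

/-! ### Garside-type identities in a group with braid relations -/

namespace BraidWords

variable {G : Type*} [Group G]

/-- The product `s 0 * s 1 * ⋯ * s (k - 1)`. -/
def ascent (s : ℕ → G) : ℕ → G
  | 0 => 1
  | k + 1 => ascent s k * s k

/-- The Garside element in the first `k` generators. -/
def halfTwist (s : ℕ → G) : ℕ → G
  | 0 => 1
  | k + 1 => ascent s (k + 1) * halfTwist s k

/-- The braid relations between the first `K` members of the sequence `s`. -/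
structure BraidRel (s : ℕ → G) (K : ℕ) : Prop where
  comm : ∀ i j, i + 2 ≤ j → j < K → s i * s j = s j * s i
  braid : ∀ i, i + 1 < K → s i * s (i + 1) * s i = s (i + 1) * s i * s (i + 1)

/-- The positive words in the generators with indices in `[a, b)`. -/
def positiveWords (s : ℕ → G) (a b : ℕ) : Submonoid G :=
  Submonoid.closure {g | ∃ i, a ≤ i ∧ i < b ∧ g = s i}

theorem generator_mem {s : ℕ → G} {a b i : ℕ} (h : a ≤ i) (h' : i < b) :
    s i ∈ positiveWords s a b :=
  Submonoid.subset_closure ⟨i, h, h', rfl⟩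

theorem ascent_mem (s : ℕ → G) {k b : ℕ} (h : k ≤ b) : ascent s k ∈ positiveWords s 0 b := by
  induction k with
  | zero => exact one_mem _
  | succ k ih => exact mul_mem (ih (by omega)) (generator_mem (by omega) (by omega))

theorem halfTwist_mem (s : ℕ → G) {k b : ℕ} (h : k ≤ b) :
    halfTwist s k ∈ positiveWords s 0 b := by
  induction k with
  | zero => exact one_mem _
  | succ k ih => exact mul_mem (ascent_mem s h) (ih (by omega))

theorem ascent_succ_eq_mul (s : ℕ → G) {k b : ℕ} (h : k < b) :
    ∃ E ∈ positiveWords s 1 b, ascent s (k + 1) = s 0 * E := by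
  induction k with
  | zero => exact ⟨1, one_mem _, by simp [ascent]⟩
  | succ k ih =>
    obtain ⟨E, hE, h'⟩ := ih (by omega)
    exact ⟨E * s (k + 1), mul_mem hE (generator_mem (by omega) h), by
      rw [ascent, h', mul_assoc]⟩

theorem halfTwist_succ_eq_mul (s : ℕ → G) {k b : ℕ} (h : k < b) :
    ∃ E ∈ positiveWords s 0 b, halfTwist s (k + 1) = E * s 0 := by
  induction k with
  | zero => exact ⟨1, one_mem _, by simp [halfTwist, ascent]⟩
  | succ k ih =>
    obtain ⟨E, hE, h'⟩ := ih (by omega)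
    exact ⟨_, mul_mem (ascent_mem s (show k + 2 ≤ b by omega)) hE, by
      rw [halfTwist, h', mul_assoc]⟩

theorem commute_of_mem_positiveWords {s : ℕ → G} {a b : ℕ} {x g : G}
    (h : ∀ i, a ≤ i → i < b → Commute x (s i)) (hg : g ∈ positiveWords s a b) : Commute x g := by
  induction hg using Submonoid.closure_induction with
  | mem g hg =>
    obtain ⟨i, h1, h2, rfl⟩ := hg
    exact h i h1 h2
  | one => exact Commute.one_right x
  | mul g g' _ _ hg hg' => exact hg.mul_right hg'

namespace BraidRel

variable {s : ℕ → G} {K : ℕ} (h : BraidRel s K)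
include h

theorem commute_ascent {k j : ℕ} (hkj : k < j) (hj : j < K) : Commute (s j) (ascent s k) :=
  commute_of_mem_positiveWords (fun i _ hi => (h.comm i j (by omega) hj).symm)
    (ascent_mem s le_rfl)

theorem commute_halfTwist {k j : ℕ} (hkj : k < j) (hj : j < K) :
    Commute (s j) (halfTwist s k) :=
  commute_of_mem_positiveWords (fun i _ hi => (h.comm i j (by omega) hj).symm)
    (halfTwist_mem s le_rfl)

/-- Move `s i` left past the letters that commute with it, apply one braid relation, and move the
resulting `s (i + 1)` to the front. -/
theorem ascent_mul {k i : ℕ} (hik : i + 1 < k) (hk : k ≤ K) :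
    ascent s k * s i = s (i + 1) * ascent s k := by
  induction k with
  | zero => omega
  | succ k ih =>
    rcases Nat.lt_or_ge (i + 1) k with h1 | h1
    · rw [ascent, mul_assoc, ← h.comm i k (by omega) (by omega), ← mul_assoc,
        ih h1 (by omega), mul_assoc]
    · obtain rfl : k = i + 1 := by omega
      have hc := (h.commute_ascent (show i < i + 1 by omega) (by omega)).eq
      rw [ascent, ascent, mul_assoc (ascent s i), mul_assoc (ascent s i), h.braid i (by omega),
        mul_assoc (s (i + 1)), ← mul_assoc (ascent s i), ← hc, mul_assoc]

/-- Letters of the shorter ascent pass through the longer one with index raised by one, and so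
extend the initial `s 0` to an ascent. -/
theorem ascent_mul_ascent {k : ℕ} (hk : k + 1 ≤ K) :
    s 0 * ascent s (k + 1) * ascent s k = ascent s (k + 1) * ascent s (k + 1) := by
  have key : ∀ j, j ≤ k → s 0 * ascent s (k + 1) * ascent s j
      = ascent s (j + 1) * ascent s (k + 1) := by
    intro j hj
    induction j with
    | zero => simp [ascent]
    | succ j ih =>
      rw [show ascent s (j + 1) = ascent s j * s j from rfl, ← mul_assoc, ih (by omega), mul_assoc,
        h.ascent_mul (by omega) hk, ← mul_assoc]
      rfl
  exact key k le_rfl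

/-- Conjugation by the Garside element reverses the generators. For all but the last index,
induction reverses within `halfTwist s k` and the ascent shifts by one; the last index reduces to
`ascent_mul_ascent`. -/
theorem halfTwist_mul {k i : ℕ} (hik : i < k) (hk : k ≤ K) :
    halfTwist s k * s i = s (k - 1 - i) * halfTwist s k := by
  induction k generalizing i with
  | zero => omega
  | succ k ih =>
    rcases Nat.lt_or_ge i k with h1 | h1
    · rw [halfTwist, mul_assoc, ih h1 (by omega), ← mul_assoc,
        h.ascent_mul (by omega) hk, mul_assoc]
      congr 2
      omega
    · obtain rfl : i = k := by omega
      rw [show i + 1 - 1 - i = 0 by omega]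
      cases i with
      | zero => simp [halfTwist, ascent]
      | succ i =>
        have hc := (h.commute_halfTwist (show i < i + 1 by omega) (by omega)).eq
        rw [halfTwist, halfTwist, mul_assoc, mul_assoc (ascent s (i + 1)), ← hc,
          ← mul_assoc (ascent s (i + 1)), ← mul_assoc (s 0), ← mul_assoc (s 0 * _),
          h.ascent_mul_ascent (by omega), mul_assoc (ascent s (i + 1 + 1)) (ascent s (i + 1 + 1))]
        rfl

theorem conj_mem {k a b : ℕ} (hk : k ≤ K) (hb : b ≤ k) {g : G} (hg : g ∈ positiveWords s a b) :
    halfTwist s k * g * (halfTwist s k)⁻¹ ∈ positiveWords s (k - b) (k - a) := by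
  induction hg using Submonoid.closure_induction with
  | mem g hg =>
    obtain ⟨i, h1, h2, rfl⟩ := hg
    rw [h.halfTwist_mul (by omega) hk, mul_inv_cancel_right]
    exact generator_mem (by omega) (by omega)
  | one => simp
  | mul g g' _ _ hg hg' =>
    convert mul_mem hg hg' using 1
    group

theorem commute_fullTwist {i : ℕ} (hi : i < K) : Commute (halfTwist s K ^ 2) (s i) := by
  have h1 := h.halfTwist_mul hi le_rfl
  have h2 := h.halfTwist_mul (show K - 1 - i < K by omega) le_rfl
  rw [show K - 1 - (K - 1 - i) = i by omega] at h2
  rw [Commute, SemiconjBy, pow_two, mul_assoc, h1, ← mul_assoc, h2, mul_assoc]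

/-- Write Δ = A H with A = `s 0` E the full ascent and H the shorter half twist. Centrality of Δ²
gives Δ² = A Δ (Δ H Δ⁻¹). Expanding the inner Δ as its own conjugate by Δ exposes the second `s 0`,
since Δ sends the last generator to the first; all other conjugated factors lose `s 0`. Finally H
also begins with the next-to-last generator, which Δ sends to `s 1`. -/
theorem exists_fullTwist_eq (hK : 2 ≤ K) :
    ∃ U ∈ positiveWords s 1 K, ∃ V ∈ positiveWords s 1 K,
      halfTwist s K ^ 2 = s 0 * U * s 0 * s 1 * V := by
  obtain ⟨k, rfl⟩ : ∃ k, K = k + 2 := ⟨K - 2, by omega⟩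
  obtain ⟨E, hE, hE'⟩ := ascent_succ_eq_mul s (show k + 1 < k + 2 by omega)
  obtain ⟨F, hF, hF'⟩ := halfTwist_succ_eq_mul s (show k < k + 1 by omega)
  have hs := h.halfTwist_mul (show 0 < k + 1 by omega) (by omega)
  have hlast := h.halfTwist_mul (show k + 1 < k + 2 by omega) le_rfl
  have hpen := h.halfTwist_mul (show k < k + 2 by omega) le_rfl
  rw [show k + 2 - 1 - (k + 1) = 0 by omega] at hlast
  rw [show k + 2 - 1 - k = 1 by omega] at hpen
  rw [show k + 1 - 1 - 0 = k by omega, hF', ← mul_assoc (s k)] at hs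
  have hs' : F * s 0 = s k * F := mul_right_cancel hs
  have hcF := h.conj_mem le_rfl (show k + 1 ≤ k + 2 by omega) hF
  have hcA := h.conj_mem le_rfl (show k + 1 ≤ k + 2 by omega) (ascent_mem s (le_refl (k + 1)))
  have hcH := h.conj_mem le_rfl (show k + 1 ≤ k + 2 by omega) (halfTwist_mem s (le_refl (k + 1)))
  rw [show k + 2 - (k + 1) = 1 by omega, Nat.sub_zero] at hcF hcA hcH
  obtain ⟨Δ, hΔ⟩ : ∃ Δ, Δ = halfTwist s (k + 2) := ⟨_, rfl⟩
  rw [← hΔ] at hlast hpen hcF hcA hcH ⊢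
  have hΔ2 : ∀ g ∈ positiveWords s 0 (k + 2), Δ * Δ * g = g * (Δ * Δ) := fun g hg => by
    have := commute_of_mem_positiveWords (fun i _ hi => h.commute_fullTwist hi) hg
    rwa [← hΔ, pow_two] at this
  refine ⟨_, mul_mem hE hcA, _, mul_mem hcF hcH, ?_⟩
  have e1 : Δ = ascent s (k + 2) * halfTwist s (k + 1) := hΔ
  have e2 : ascent s (k + 2) = ascent s (k + 1) * s (k + 1) := rfl
  have e3 := hΔ2 _ (halfTwist_mem s (show k + 1 ≤ k + 2 by omega))
  have e4 : halfTwist s (k + 1) * Δ = Δ * (Δ * halfTwist s (k + 1) * Δ⁻¹) := by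
    rw [← mul_assoc, ← mul_assoc, e3]; group
  have e5 : Δ = Δ * ascent s (k + 1) * Δ⁻¹ * s 0 * (Δ * halfTwist s (k + 1) * Δ⁻¹) := by
    have hl : s 0 = Δ * s (k + 1) * Δ⁻¹ := by rw [hlast]; group
    calc Δ = Δ * (ascent s (k + 1) * s (k + 1) * halfTwist s (k + 1)) * Δ⁻¹ := by
          rw [← e2, ← e1]; group
      _ = Δ * ascent s (k + 1) * Δ⁻¹ * (Δ * s (k + 1) * Δ⁻¹) *
          (Δ * halfTwist s (k + 1) * Δ⁻¹) := by group
      _ = _ := by rw [← hl]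
  have e6 : Δ * halfTwist s (k + 1) * Δ⁻¹ = s 1 * (Δ * F * Δ⁻¹) := by
    rw [hF', hs', ← mul_assoc, hpen]; group
  calc Δ ^ 2 = ascent s (k + 2) * (halfTwist s (k + 1) * Δ) := by
        rw [pow_two, ← mul_assoc, ← e1]
    _ = s 0 * E * Δ * (Δ * halfTwist s (k + 1) * Δ⁻¹) := by rw [e4, hE', ← mul_assoc]
    _ = s 0 * E * (Δ * ascent s (k + 1) * Δ⁻¹ * s 0 * (Δ * halfTwist s (k + 1) * Δ⁻¹)) *
          (Δ * halfTwist s (k + 1) * Δ⁻¹) := by rw [← e5]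
    _ = _ := by
      conv_lhs => enter [1, 2, 2]; rw [e6]
      simp only [mul_assoc]

end BraidRel

/-- Products of conjugates of one generator: `k + 1` positive half twists whose product is `k` full
twists, up to a correction by one generator and a negative word avoiding it. -/
theorem BraidRel.exists_prod_conj_eq {s : ℕ → G} {K : ℕ} (h : BraidRel s K) (hK : 2 ≤ K) (k : ℕ) :
    ∃ L : List G, L.length = k + 1 ∧ (∀ x ∈ L, ∃ w, x = w * s 0 * w⁻¹) ∧
      ∃ c ∈ positiveWords s 1 K, L.prod = (halfTwist s K ^ 2) ^ k * (s 0 * c⁻¹) := by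
  obtain ⟨U, hU, V, hV, hz⟩ := h.exists_fullTwist_eq hK
  set z := halfTwist s K ^ 2
  have hc : ∀ g ∈ positiveWords s 0 K, Commute z g := fun g hg =>
    commute_of_mem_positiveWords (fun i _ hi => h.commute_fullTwist hi) hg
  have hmono : positiveWords s 1 K ≤ positiveWords s 0 K :=
    Submonoid.closure_mono fun g ⟨i, _, h2, h3⟩ => ⟨i, by omega, h2, h3⟩
  have hb := h.braid 0 (by omega)
  rw [zero_add] at hb
  -- Use s₁ s₀ = s₀ (s₁ s₀ s₁⁻¹), then replace s₀ U s₀ by z V⁻¹ s₁⁻¹.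
  have key : V * s 0 * (U * s 1) * s 0 = z * (s 0 * (s 1)⁻¹) := by
    have e1 : s 1 * s 0 = s 0 * (s 1 * s 0 * (s 1)⁻¹) := by
      rw [← mul_assoc, ← mul_assoc, hb]; group
    have e2 : s 0 * U * s 0 = z * V⁻¹ * (s 1)⁻¹ := by rw [hz]; group
    have e3 := (hc V (hmono hV)).eq
    calc V * s 0 * (U * s 1) * s 0 = V * (s 0 * U * (s 1 * s 0)) := by group
      _ = V * (s 0 * U * (s 0 * (s 1 * s 0 * (s 1)⁻¹))) := by rw [← e1]
      _ = V * (s 0 * U * s 0 * (s 1 * s 0 * (s 1)⁻¹)) := by group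
      _ = V * z * V⁻¹ * s 0 * (s 1)⁻¹ := by rw [e2]; group
      _ = _ := by rw [← e3]; group
  induction k with
  | zero =>
    exact ⟨[s 0], rfl, fun x hx => ⟨1, by simpa using hx⟩, 1, one_mem _, by simp⟩
  | succ k ih =>
    obtain ⟨L, hL, hL', c, hcm, hprod⟩ := ih
    set Y := U * s 1 with hY
    have hYm : Y ∈ positiveWords s 1 K := mul_mem hU (generator_mem le_rfl (by omega))
    -- Prepend a conjugate of `s 0`, then conjugate the whole list by `V * Y`: this creates the left
    -- side of `key` and pushes the remaining letters into the negative tail.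
    refine ⟨((Y⁻¹ * s 0 * Y) :: L).map (MulAut.conj (V * Y)), by simp [hL], ?_,
      V * Y * c * s 1, ?_, ?_⟩
    · intro x hx
      obtain ⟨y, hy, rfl⟩ := List.mem_map.1 hx
      rcases List.mem_cons.1 hy with rfl | hy
      · exact ⟨V * Y * Y⁻¹, by simp only [MulAut.conj_apply]; group⟩
      · obtain ⟨w, rfl⟩ := hL' y hy
        exact ⟨V * Y * w, by simp only [MulAut.conj_apply]; group⟩
    · exact mul_mem (mul_mem (mul_mem hV hYm) hcm) (generator_mem le_rfl (by omega))
    · have hzk : ∀ g ∈ positiveWords s 0 K, z ^ k * g = g * z ^ k := fun g hg =>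
        ((hc g hg).pow_left k).eq
      rw [← map_list_prod, List.prod_cons, hprod, MulAut.conj_apply]
      have e0 : V * s 0 * Y * z ^ k = z ^ k * (V * s 0 * Y) :=
        (hzk _ (mul_mem (mul_mem (hmono hV) (generator_mem le_rfl (by omega))) (hmono hYm))).symm
      calc V * Y * (Y⁻¹ * s 0 * Y * (z ^ k * (s 0 * c⁻¹))) * (V * Y)⁻¹
          = V * s 0 * Y * z ^ k * s 0 * c⁻¹ * (V * Y)⁻¹ := by group
        _ = z ^ k * (V * s 0 * Y * s 0) * c⁻¹ * (V * Y)⁻¹ := by rw [e0]; group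
        _ = _ := by rw [key, pow_succ]; group

end BraidWords

/-! ### Dehornoy floors of powers and the fractional Dehn twist coefficient -/

namespace PuncturedDisk

open BraidWords

/-- The standard generators, as a sequence indexed by the natural numbers. -/
noncomputable def sigmaSeq (n : ℕ) (i : ℕ) : MCG n := if h : i < n - 1 then sigma ⟨i, h⟩ else 1

theorem sigmaSeq_of_lt {n i : ℕ} (h : i < n - 1) : sigmaSeq n i = sigma ⟨i, h⟩ := dif_pos h

theorem sigmaSeq_coe {n : ℕ} (i : Fin (n - 1)) : sigmaSeq n i = sigma i := sigmaSeq_of_lt i.2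

/-- The bound `n - 1` matters: the sequence continues with the value 1, and a braid relation across
that end would make a generator trivial. -/
theorem braidRel_sigmaSeq (n : ℕ) : BraidRel (sigmaSeq n) (n - 1) where
  comm i j hij hj := by
    rw [sigmaSeq_of_lt hj, sigmaSeq_of_lt (by omega : i < n - 1)]
    exact sigma_comm _ _ hij
  braid i hi := by
    rw [sigmaSeq_of_lt hi, sigmaSeq_of_lt (by omega : i < n - 1)]
    exact sigma_braid _ _ rfl

theorem prod_map_range {G : Type*} [Group G] (s : ℕ → G) (k : ℕ) :
    ((List.range k).map s).prod = ascent s k := by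
  induction k with
  | zero => rfl
  | succ k ih => rw [List.range_succ, List.map_append, List.prod_append, ih]; simp [ascent]

theorem filter_range_le {k m : ℕ} (h : k < m) :
    (List.range m).filter (· ≤ k) = List.range (k + 1) := by
  obtain ⟨d, rfl⟩ := Nat.exists_eq_add_of_lt h
  rw [show k + d + 1 = k + 1 + d by omega, List.range_add, List.filter_append,
    List.filter_eq_self.2, List.filter_eq_nil_iff.2, List.append_nil]
  · simp
    omega
  · simp

theorem garside_eq_halfTwist (n : ℕ) : garside n = halfTwist (sigmaSeq n) (n - 1) := by
  have h1 : ∀ k : Fin (n - 1), (((List.finRange (n - 1)).filter (· ≤ k)).map sigma).prod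
      = ascent (sigmaSeq n) (k + 1) := fun k => by
    rw [← prod_map_range, ← filter_range_le k.2, ← List.map_coe_finRange_eq_range,
      List.filter_map, List.map_map]
    congr 2
    exact funext fun i => (sigmaSeq_coe i).symm
  have h2 : ∀ k, ((List.range k).reverse.map fun i => ascent (sigmaSeq n) (i + 1)).prod
      = halfTwist (sigmaSeq n) k := fun k => by
    induction k with
    | zero => rfl
    | succ k ih =>
      simp only [List.range_succ, List.reverse_append, List.reverse_singleton, List.map_append,
        List.map_cons, List.map_nil, List.prod_append, ih]
      simp [halfTwist]
  rw [garside, ← h2, ← List.map_coe_finRange_eq_range, ← List.map_reverse, List.map_map]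
  simp only [h1]
  rfl

/-- The elements represented by words without the inverse of the first generator. -/
noncomputable def nonnegWords (n : ℕ) : Submonoid (MCG n) :=
  Submonoid.closure {g | ∃ x : Fin (n - 1) × Bool, ((x.1 : ℕ) = 0 → x.2 = true) ∧ g = letter x}

theorem sigmaSeq_mem_nonnegWords {n i : ℕ} (h : i < n - 1) : sigmaSeq n i ∈ nonnegWords n :=
  Submonoid.subset_closure ⟨(⟨i, h⟩, true), fun _ => rfl, by simp [letter, sigmaSeq_of_lt h]⟩

theorem sigmaSeq_inv_mem_nonnegWords {n i : ℕ} (h0 : 1 ≤ i) (h : i < n - 1) :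
    (sigmaSeq n i)⁻¹ ∈ nonnegWords n :=
  Submonoid.subset_closure ⟨(⟨i, h⟩, false), fun h' => absurd h' (by simp; omega),
    by simp [letter, sigmaSeq_of_lt h]⟩

theorem mem_nonnegWords_of_positive {n a b : ℕ} (hb : b ≤ n - 1) {g : MCG n}
    (hg : g ∈ positiveWords (sigmaSeq n) a b) : g ∈ nonnegWords n := by
  refine Submonoid.closure_le.2 ?_ hg
  rintro _ ⟨i, _, hi, rfl⟩
  exact sigmaSeq_mem_nonnegWords (by omega)

theorem inv_mem_nonnegWords_of_positive {n : ℕ} {g : MCG n}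
    (hg : g ∈ positiveWords (sigmaSeq n) 1 (n - 1)) : g⁻¹ ∈ nonnegWords n := by
  induction hg using Submonoid.closure_induction with
  | mem g hg =>
    obtain ⟨i, h1, h2, rfl⟩ := hg
    exact sigmaSeq_inv_mem_nonnegWords h1 h2
  | one => simp
  | mul g g' _ _ hg hg' =>
    rw [mul_inv_rev]
    exact mul_mem hg' hg

theorem exists_word_of_mem_nonnegWords {n : ℕ} {g : MCG n} (hg : g ∈ nonnegWords n) :
    ∃ w : List (Fin (n - 1) × Bool), (∀ x ∈ w, (x.1 : ℕ) = 0 → x.2 = true) ∧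
      (w.map letter).prod = g := by
  induction hg using Submonoid.closure_induction with
  | mem g hg =>
    obtain ⟨x, hx, rfl⟩ := hg
    exact ⟨[x], by simpa using hx, by simp⟩
  | one => exact ⟨[], by simp, rfl⟩
  | mul g g' _ _ hg hg' =>
    obtain ⟨w, hw, rfl⟩ := hg
    obtain ⟨w', hw', rfl⟩ := hg'
    refine ⟨w ++ w', fun x hx => ?_, by simp⟩
    rcases List.mem_append.1 hx with hx | hx
    exacts [hw x hx, hw' x hx]

/-- Index 0 is the smallest, so the ban on smaller indices is vacuous: one positive first generator
and no inverse of it suffice. -/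
theorem sigmaPositive_of_mem {n : ℕ} (hn : 0 < n - 1) {g g' : MCG n} (hg : g ∈ nonnegWords n)
    (hg' : g' ∈ nonnegWords n) : SigmaPositive (g * sigmaSeq n 0 * g') := by
  obtain ⟨w, hw, rfl⟩ := exists_word_of_mem_nonnegWords hg
  obtain ⟨w', hw', rfl⟩ := exists_word_of_mem_nonnegWords hg'
  refine ⟨⟨0, hn⟩, w ++ (⟨0, hn⟩, true) :: w', by simp, fun h => ?_, fun x _ => Nat.zero_le _, ?_⟩
  · rcases List.mem_append.1 h with h | h
    · simpa using hw _ h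
    · rcases List.mem_cons.1 h with h | h
      · simp at h
      · simpa using hw' _ h
  · rw [List.map_append, List.prod_append, List.map_cons, List.prod_cons, ← mul_assoc,
      sigmaSeq_of_lt hn]
    simp [letter]

/-- A power of the full twist, times a positive first generator, times a negative word in the other
generators, has an integral fractional Dehn twist coefficient. -/
theorem hasFDTC_fullTwist_pow_mul {n : ℕ} (hn : 3 ≤ n) (k : ℕ) {c : MCG n}
    (hc : c ∈ positiveWords (sigmaSeq n) 1 (n - 1)) :
    HasFDTC ((halfTwist (sigmaSeq n) (n - 1) ^ 2) ^ k * (sigmaSeq n 0 * c⁻¹)) k := by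
  have hB := braidRel_sigmaSeq n
  have hG := garside_eq_halfTwist n
  set Δ := halfTwist (sigmaSeq n) (n - 1) with hΔ
  set x := sigmaSeq n 0 * c⁻¹ with hx
  have hΔm : Δ ∈ nonnegWords n :=
    mem_nonnegWords_of_positive le_rfl (halfTwist_mem (sigmaSeq n) (le_refl (n - 1)))
  have hcm := inv_mem_nonnegWords_of_positive hc
  have hxm : x ∈ nonnegWords n := mul_mem (sigmaSeq_mem_nonnegWords (by omega)) hcm
  have hcomm : Commute (Δ ^ 2) x := by
    refine (hB.commute_fullTwist (by omega)).mul_right (Commute.inv_right ?_)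
    exact commute_of_mem_positiveWords (fun i _ hi => hB.commute_fullTwist hi) hc
  obtain ⟨E, hE, hE'⟩ : ∃ E ∈ nonnegWords n, Δ = sigmaSeq n 0 * E := by
    obtain ⟨E, hE, h⟩ := ascent_succ_eq_mul (sigmaSeq n) (show n - 2 < n - 1 by omega)
    refine ⟨E * halfTwist (sigmaSeq n) (n - 2),
      mul_mem (mem_nonnegWords_of_positive le_rfl hE)
        (mem_nonnegWords_of_positive (show n - 2 ≤ n - 1 by omega)
          (halfTwist_mem (sigmaSeq n) le_rfl)), ?_⟩
    rw [hΔ, show n - 1 = n - 2 + 1 by omega, halfTwist, h, mul_assoc]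
  -- The reversal turns `(s 0)⁻¹` into the inverse of the generator of index `n - 2`, which is at
  -- least 1 because `n ≥ 3`; the factor from `c` stays positive.
  have hy : Δ * x⁻¹ * Δ⁻¹ ∈ nonnegWords n := by
    have h1 := hB.halfTwist_mul (show 0 < n - 1 by omega) le_rfl
    have h2 := hB.conj_mem le_rfl le_rfl hc
    have e : Δ * x⁻¹ * Δ⁻¹ = Δ * c * Δ⁻¹ * (sigmaSeq n (n - 1 - 1 - 0))⁻¹ := by
      rw [← hΔ] at h1
      rw [eq_mul_inv_of_mul_eq h1.symm, hx]
      group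
    rw [e]
    exact mul_mem (mem_nonnegWords_of_positive (by omega) h2)
      (sigmaSeq_inv_mem_nonnegWords (by omega) (by omega))
  have hpow : ∀ N : ℕ, ((Δ ^ 2) ^ k * x) ^ N = (Δ ^ 2) ^ (k * N) * x ^ N := fun N => by
    rw [(hcomm.pow_left k).mul_pow, ← pow_mul]
  have hz : ∀ N : ℕ, garside n ^ (2 * ((k * N : ℕ) : ℤ)) = (Δ ^ 2) ^ (k * N) := fun N => by
    rw [hG, zpow_mul, zpow_natCast]
    rfl
  refine ⟨fun N => ((k * N : ℕ) : ℤ), fun N => ⟨?_, ?_⟩, ?_⟩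
  · rw [hz, hpow]
    -- For `N = 0` there is equality; otherwise the leading `s 0` of `x ^ N` gives strict
    -- inequality.
    cases N with
    | zero => left; simp
    | succ N =>
      right
      rw [DehornoyLT, inv_mul_cancel_left, pow_succ', hx, mul_assoc, ← one_mul (sigmaSeq n 0 * _),
        ← hx, ← mul_assoc]
      exact sigmaPositive_of_mem (by omega) (one_mem _) (mul_mem hcm (pow_mem hxm N))
  -- Centrality of Δ² cancels the full twists and splits the remaining one around `x⁻ᴺ`, whose
  -- conjugate by Δ is harmless by `hy`; the last Δ supplies `s 0`.
  · have e : (((Δ ^ 2) ^ k * x) ^ N)⁻¹ * garside n ^ (2 * ((k * N : ℕ) : ℤ) + 2)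
        = Δ * (Δ * x⁻¹ * Δ⁻¹) ^ N * sigmaSeq n 0 * E := by
      rw [hpow, zpow_add, hz, hG, mul_assoc _ (sigmaSeq n 0), ← hE', conj_pow, mul_inv_rev,
        mul_assoc, inv_mul_cancel_left]
      have h := ((hcomm.pow_right N).inv_right).eq
      rw [inv_pow]
      calc (x ^ N)⁻¹ * Δ ^ (2 : ℤ) = Δ ^ 2 * (x ^ N)⁻¹ := h.symm
        _ = _ := by rw [pow_two]; group
    rw [DehornoyLT, e]
    exact sigmaPositive_of_mem (by omega) (mul_mem hΔm (pow_mem hy N)) hE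
  · refine tendsto_const_nhds.congr' ?_
    filter_upwards [Filter.eventually_gt_atTop 0] with N hN
    have : (N : ℝ) ≠ 0 := by positivity
    push_cast
    field_simp

end PuncturedDisk

open PuncturedDisk BraidWords in
theorem proposition4p8 (n : ℕ) (hn : 3 ≤ n) (m : ℕ) (hm : 2 ≤ m) :
    ∃ (γ : Fin m → PuncturedDisk.PunctureArc n) (H : Fin m → PuncturedDisk.MCG n),
      (∀ j, PuncturedDisk.IsHalfTwist (γ j) (H j)) ∧
      PuncturedDisk.HasFDTC (List.ofFn H).reverse.prod ((m : ℝ) - 1) := by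
  obtain ⟨L, hL, hconj, c, hc, hprod⟩ :=
    (braidRel_sigmaSeq n).exists_prod_conj_eq (by omega) (m - 1)
  -- The composition applies `γ 0` first, so its twist is the rightmost factor: the twists are
  -- listed by `L.reverse`.
  have hlen : L.reverse.length = m := by rw [List.length_reverse, hL]; omega
  have hex : ∀ j : Fin m, ∃ γ : PunctureArc n, IsHalfTwist γ (L.reverse.get (j.cast hlen.symm)) :=
    fun j => by
      obtain ⟨w, hw⟩ := hconj _ (List.mem_reverse.1 (L.reverse.get_mem (j.cast hlen.symm)))
      rw [hw, sigmaSeq_of_lt (by omega : 0 < n - 1)]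
      exact exists_isHalfTwist_conj w _
  choose γ hγ using hex
  refine ⟨γ, _, hγ, ?_⟩
  have hofFn : List.ofFn (fun j : Fin m => L.reverse.get (j.cast hlen.symm)) = L.reverse :=
    List.ext_getElem (by simp [hL]; omega) (by simp)
  rw [hofFn, List.reverse_reverse, hprod]
  have h := hasFDTC_fullTwist_pow_mul hn (m - 1) hc
  rwa [Nat.cast_sub (by omega), Nat.cast_one] at h
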